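/- Conventions. Modules are left modules, and $\operatorname{mod}\Lambda$ is the category of finitely generated $\Lambda$-modules. An \emph{artin algebra} is an algebra over a commutative artinian ring $R$ which is finitely generated as an $R$-module; for it put $\mathcal M_\Lambda:=\operatorname{mod}\Lambda$. For a complete discrete valuation ring $R$ with quotient field $K$, an \emph{$R$-order} is an $R$-algebra $\Lambda$ which is finitely generated projective as an $R$-module; it is an \emph{order in a semisimple algebra} if $\Lambda\otimes_RK$ is semisimple. For an order, $\mathcal M_\Lambda$ denotes the category of $\Lambda$-lattices, i.e. of the $\Lambda$-modules which are finitely generated projective over $R$. In both cases put $$r_\Lambda(M):=\inf\{\operatorname{gl.dim}\operatorname{End}_\Lambda(M\oplus N)\mid N\in\mathcal M_\Lambda\}\qquad(M\in\mathcal M_\Lambda).$$ For an $R$-order $\Lambda$, let $\operatorname{exp.dim}\Lambda$ be the infimum of $\operatorname{gl.dim}\Gamma$ over all $R$-orders $\Gamma$ for which there is a finitely generated projective $\Gamma$-module $P$ with $\operatorname{End}_\Gamma(P)$ Morita equivalent (as an $R$-algebra) to $\Lambda$. Let $\mathcal X_2:=\operatorname{add}\Omega^2(\operatorname{mod}\Lambda)$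 be the class of direct summands of finite direct sums of second syzygies of finitely generated $\Lambda$-modules (with respect to arbitrary finitely generated projective resolutions). A module $X$ is \emph{reflexive} if the evaluation map $X\to X^{**}$ with $(\ )^*=\operatorname{Hom}(\ ,\Lambda)$ is bijective, and $\Lambda$ is \emph{reflexive-finite} if there are only finitely many isomorphism classes of indecomposable finitely generated reflexive $\Lambda$-modules. An artin algebra $\Lambda$ is \emph{$1$-Gorenstein} if the injective hull of the left $\Lambda$-module $\Lambda$ is projective. Theorem. (1) Let $\Lambda$ be an artin algebra. If $r_\Lambda(\Lambda)\le 2$, then $\mathcal X_2$ contains only finitely many indecomposable modules up to isomorphism. Conversely, if $\mathcal X_2$ contains only finitely many indecomposable modules up to isomorphism and every module in $\mathcal X_2$ is reflexive, then $r_\Lambda(\Lambda)\le2$. In particular, if $\Lambda$ is $1$-Gorenstein, then $r_\Lambda(\Lambda)\le 2$ if and only if $\Lambda$ is reflexive-finite. (2) Let $\Lambda$ be an order over a complete discrete valuation ring in a semisimple algebra. Then the conditions $r_\Lambda(\Lambda)\le2$, $\operatorname{exp.dim}\Lambda\le2$, and "$\Lambda$ is reflexive-finite" are equivalent. -/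

import Mathlib

open CategoryTheory
open scoped TensorProduct

universe u

namespace RepDim

/-! ### Homological dimensions of rings -/

/-- The (left) global dimension of a ring: the supremum of the projective dimensions of all its
left modules. The value is `⊥` exactly for the zero ring. -/
noncomputable def gldim (A : Type u) [Ring A] : WithBot ℕ∞ :=
  ⨆ X : ModuleCat.{u} A, projectiveDimension X

/-- `End_Λ(M)`, with the product `f * g` being "first `f`, then `g`". This is the convention under
which `Hom_Λ(M, Y)` is a left `End_Λ(M)`-module, and under which `End_Λ(Λ)` is `Λ`. -/
abbrev EndRing (Λ : Type u) [Ring Λ] (M : Type u) [AddCommGroup M] [Module Λ M] : Type u :=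
  (Module.End Λ M)ᵐᵒᵖ

section Modules

variable {Λ : Type u} [Ring Λ]

/-- The number `r_Λ(M)`, taken with respect to a collection `C` of modules: the infimum of
`gl.dim End_Λ(M ⊕ N)` over all `N` in `C`. -/
noncomputable def rFun (C : ModuleCat.{u} Λ → Prop) (M : ModuleCat.{u} Λ) : WithBot ℕ∞ :=
  ⨅ N : {N : ModuleCat.{u} Λ // C N}, gldim (EndRing Λ (M × N.1))

/-- `mod Λ`: the finitely generated left modules. -/
def IsFG (X : ModuleCat.{u} Λ) : Prop := Module.Finite Λ X

/-- `ind C`: the isomorphism classes of indecomposable modules in `C`. -/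
def ind (C : ModuleCat.{u} Λ → Prop) : Set (Quotient (isIsomorphicSetoid (ModuleCat.{u} Λ))) :=
  {c | ∃ X : ModuleCat.{u} Λ, C X ∧ Indecomposable X ∧ Quotient.mk _ X = c}

/-- `add S`: the direct summands of finite direct sums of modules in `S`. -/
def InAdd (S : ModuleCat.{u} Λ → Prop) (X : ModuleCat.{u} Λ) : Prop :=
  ∃ (n : ℕ) (Y : Fin n → ModuleCat.{u} Λ), (∀ i, S (Y i)) ∧
    ∃ (ι : X →ₗ[Λ] (∀ i, Y i)) (π : (∀ i, Y i) →ₗ[Λ] X), π ∘ₗ ι = LinearMap.id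

/-- `IsSyzygy n K X`: the module `K` is an `n`-th syzygy of `X`, that is, there is an exact
sequence `0 → K → P_{n-1} → ⋯ → P_0 → X → 0` with finitely generated projective `P_i`. -/
def IsSyzygy : ℕ → ModuleCat.{u} Λ → ModuleCat.{u} Λ → Prop
  | 0, K, X => Nonempty (K ≃ₗ[Λ] X)
  | n + 1, K, X => ∃ (P : ModuleCat.{u} Λ) (f : P →ₗ[Λ] X),
      Module.Finite Λ P ∧ Module.Projective Λ P ∧ Function.Surjective f ∧
        IsSyzygy n K (ModuleCat.of Λ (LinearMap.ker f))

variable (Λ) in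
/-- `X_n = add Ωⁿ(mod Λ)`. -/
def AddSyzygy (n : ℕ) : ModuleCat.{u} Λ → Prop :=
  InAdd fun K => ∃ X : ModuleCat.{u} Λ, IsFG X ∧ IsSyzygy n K X

/-- The evaluation map `X → X**`, where `X* = Hom_Λ(X, Λ)` is a right `Λ`-module, written here as
a module over `Λᵐᵒᵖ`. -/
def evalDual (X : ModuleCat.{u} Λ) (x : X) : (X →ₗ[Λ] Λ) →ₗ[Λᵐᵒᵖ] Λ where
  toFun f := f x
  map_add' _ _ := rfl
  map_smul' _ _ := rfl

/-- A module is reflexive if the evaluation map `X → X**` is bijective. -/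
def IsReflexive (X : ModuleCat.{u} Λ) : Prop := Function.Bijective (evalDual X)

variable (Λ) in
/-- `Λ` has only finitely many indecomposable reflexive (finitely generated) modules. -/
def ReflexiveFinite : Prop := (ind fun X : ModuleCat.{u} Λ => IsFG X ∧ IsReflexive X).Finite

variable (Λ) in
/-- `Λ` is `1`-Gorenstein: the term `I_0` of a minimal injective resolution
`0 → Λ → I_0 → I_1 → ⋯` of the left module `Λ`, that is, the injective hull of `Λ`, is projective.
(Over an artin algebra, projective and flat modules coincide.) -/
def IsOneGorenstein : Prop :=
  ∃ (I : ModuleCat.{u} Λ) (j : Λ →ₗ[Λ] I), Function.Injective j ∧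
    (∀ N : Submodule Λ I, N ⊓ LinearMap.range j = ⊥ → N = ⊥) ∧
    Module.Injective Λ I ∧ Module.Projective Λ I

end Modules

/-! ### Orders -/

section Orders

variable (R : Type u) [CommRing R]

/-- An `R`-order (for `R` a complete discrete valuation ring): an `R`-algebra which is a finitely
generated projective `R`-module. -/
def IsOrder (Λ : Type u) [Ring Λ] [Algebra R Λ] : Prop :=
  Module.Finite R Λ ∧ Module.Projective R Λ

/-- `lat Λ`: the left `Λ`-modules which are finitely generated projective over `R`. -/
def IsLattice {Λ : Type u} [Ring Λ] [Algebra R Λ] (X : ModuleCat.{u} Λ) : Prop :=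
  Module.Finite R (RestrictScalars R Λ X) ∧ Module.Projective R (RestrictScalars R Λ X)

/-- `Λ ≼ Γ`: there is a finitely generated projective `Γ`-module `P` such that `End_Γ(P)` is
Morita equivalent to `Λ`. -/
def Precedes (Λ : Type u) [Ring Λ] [Algebra R Λ] (Γ : Type u) [Ring Γ] [Algebra R Γ] : Prop :=
  ∃ (P : Type u) (_ : AddCommGroup P) (_ : Module R P) (_ : Module Γ P) (_ : IsScalarTower R Γ P),
    Module.Finite Γ P ∧ Module.Projective Γ P ∧ IsMoritaEquivalent R (EndRing Γ P) Λ

/-- The expanded dimension of an `R`-order `Λ`: the infimum of the global dimensions of the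
`R`-orders `Γ` with `Λ ≼ Γ`. -/
noncomputable def expDim (Λ : Type u) [Ring Λ] [Algebra R Λ] : WithBot ℕ∞ :=
  sInf {d | ∃ (Γ : Type u) (_ : Ring Γ) (_ : Algebra R Γ),
    IsOrder R Γ ∧ Precedes R Λ Γ ∧ gldim Γ = d}

end Orders

end RepDim

/-! The proof is Auslander's projectivization in dimension two. For a noetherian ring, global
dimension at most 2 means that kernels of maps between free modules of finite rank are projective.
Over `End_Λ(M)` such a map is a matrix, hence a map `M^a → M^b` with some kernel `K`, and its own
kernel is `Hom_Λ(M, K)` (`kerEquivHomMod`). If `Λ` is a summand of `M`, this is projective exactly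
when `K` lies in `add M`. So `gl.dim End_Λ(M) ≤ 2` says that `add M` is closed under kernels of maps
between powers of `M`.

Second syzygies are, up to isomorphism, the kernels of maps between free modules of finite rank
(`IsFreeKernel`). If `M` contains `Λ` and `gl.dim End_Λ(M) ≤ 2`, they all lie in `add M`, and
Krull–Schmidt leaves finitely many indecomposables.

Conversely, dualizing a presentation of `X*` shows that a finitely generated reflexive `X` is such a
kernel, embedded so that its linear forms extend (`exists_approximation`). Hence kernels of maps
between reflexive modules are again kernels between free modules. If these are all reflexive and
finitely many indecomposables occur, their sum `N` gives `gl.dim End(Λ ⊕ N) ≤ 2`. For `1`-Gorenstein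
algebras and for orders in semisimple algebras, reflexivity of second syzygies follows from one
extension property, `ExtendsUpToMul`.

For orders, `Γ = End(Λ ⊕ N)` shows that `r_Λ(Λ) ≤ 2` bounds the expanded dimension. If `gl.dim Γ ≤
2` and `P` is finitely generated projective over `Γ`, kernels between free `End_Γ(P)`-modules lie in
`add Hom_Γ(P, Γ)`. Morita equivalence and Krull–Schmidt then give reflexive-finiteness, which closes
the circle. -/

namespace RepDim
open Abelian

/-! ### Global dimension at most two -/

section Homological

variable {Γ : Type u} [Ring Γ]

theorem gldim_le_two_iff :
    gldim Γ ≤ 2 ↔ ∀ X : ModuleCat.{u} Γ, HasProjectiveDimensionLE X 2 := by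
  unfold gldim
  rw [iSup_le_iff]
  exact forall_congr' fun X => projectiveDimension_le_iff X 2

/-- The short exact sequence `0 → ker f → P → range f → 0`. -/
theorem exists_shortExact_ker {P Q : Type u} [AddCommGroup P] [Module Γ P] [AddCommGroup Q]
    [Module Γ Q] (f : P →ₗ[Γ] Q) :
    ∃ S : ShortComplex (ModuleCat.{u} Γ), S.ShortExact ∧ S.X₁ = ModuleCat.of Γ (LinearMap.ker f) ∧
      S.X₂ = ModuleCat.of Γ P ∧ S.X₃ = ModuleCat.of Γ (LinearMap.range f) := by
  have hex : Function.Exact (LinearMap.ker f).subtype f.rangeRestrict := by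
    intro x
    simp [LinearMap.rangeRestrict, Subtype.ext_iff]
  refine ⟨ModuleCat.shortComplexOfCompEqZero _ _ hex.linearMap_comp_eq_zero,
    ModuleCat.shortComplex_shortExact _ hex (Submodule.injective_subtype _)
      f.surjective_rangeRestrict, rfl, rfl, rfl⟩

theorem hasProjectiveDimensionLT_ker_iff {P Q : Type u} [AddCommGroup P] [Module Γ P]
    [AddCommGroup Q] [Module Γ Q] [Module.Projective Γ P] (f : P →ₗ[Γ] Q) (n : ℕ) :
    HasProjectiveDimensionLT (ModuleCat.of Γ (LinearMap.range f)) (n + 2) ↔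
      HasProjectiveDimensionLT (ModuleCat.of Γ (LinearMap.ker f)) (n + 1) := by
  obtain ⟨S, hS, h₁, h₂, h₃⟩ := exists_shortExact_ker f
  rw [← h₁, ← h₃]
  exact hS.hasProjectiveDimensionLT_X₃_iff n (by
    rw [h₂]; exact (IsProjective.iff_projective P).1 inferInstance)

/-- `ker f` is a second syzygy of the cokernel `Q / range f`. -/
theorem projective_ker_of_gldim_le_two (h : gldim Γ ≤ 2) {P Q : Type u} [AddCommGroup P]
    [Module Γ P] [AddCommGroup Q] [Module Γ Q] [Module.Projective Γ P] [Module.Projective Γ Q]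
    (f : P →ₗ[Γ] Q) : Module.Projective Γ (LinearMap.ker f) := by
  rw [IsProjective.iff_projective, projective_iff_hasProjectiveDimensionLT_one,
    ← hasProjectiveDimensionLT_ker_iff f 0]
  have h1 := gldim_le_two_iff.1 h
    (ModuleCat.of Γ (LinearMap.range (LinearMap.range f).mkQ))
  have h2 := (hasProjectiveDimensionLT_ker_iff (LinearMap.range f).mkQ 1).1 h1
  rwa [Submodule.ker_mkQ] at h2

/-- Dimension shifting along an embedding of `Z` into an injective module reduces to `n = 0`, where
vanishing of `Ext¹(Γ/I, Z)` is Baer's criterion. -/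
theorem hasInjectiveDimensionLE_of_ext_quotient (n : ℕ) :
    ∀ Z : ModuleCat.{u} Γ, (∀ I : Ideal Γ, Subsingleton
      (Ext.{u} (ModuleCat.of Γ (Γ ⧸ I)) Z (n + 1))) → HasInjectiveDimensionLE Z n := by
  induction n with
  | zero =>
    intro Z hZ
    suffices Module.Baer Γ Z by
      have := (Module.injective_iff_injective_object Γ Z).1 this.injective
      exact (inferInstance : HasInjectiveDimensionLT Z 1)
    intro I g
    have hex : Function.Exact I.subtype I.mkQ := by intro x; simp
    let S : ShortComplex (ModuleCat.{u} Γ) :=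
      ModuleCat.shortComplexOfCompEqZero _ _ hex.linearMap_comp_eq_zero
    have hS : S.ShortExact := ModuleCat.shortComplex_shortExact S hex
      (Submodule.injective_subtype _) (Submodule.mkQ_surjective _)
    have := hZ I
    obtain ⟨x₂, hx₂⟩ := Ext.contravariant_sequence_exact₁ hS Z (n₁ := 1)
      (Ext.mk₀ (ModuleCat.ofHom g : S.X₁ ⟶ Z)) (by simp) (Subsingleton.elim _ _)
    obtain ⟨φ, rfl⟩ := Ext.homEquiv₀.symm.surjective x₂
    refine ⟨φ.hom, fun x hx => ?_⟩
    have h3 : S.f ≫ φ = ModuleCat.ofHom g := by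
      apply Ext.homEquiv₀.symm.injective
      simpa using hx₂
    exact congr($(h3).hom ⟨x, hx⟩)
  | succ n ih =>
    intro Z hZ
    obtain ⟨J, _, f, _⟩ := EnoughInjectives.presentation Z
    have injf : Function.Injective f.hom := (ModuleCat.mono_iff_injective f).mp ‹_›
    let S : ShortComplex (ModuleCat.{u} Γ) :=
      ModuleCat.shortComplexOfCompEqZero _ _ f.hom.exact_map_mkQ_range.linearMap_comp_eq_zero
    have hS : S.ShortExact := ModuleCat.shortComplex_shortExact S
      f.hom.exact_map_mkQ_range injf (Submodule.mkQ_surjective _)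
    refine (hS.hasInjectiveDimensionLT_X₃_iff n ‹_›).1 (ih S.X₃ fun I => ?_)
    have := hZ I
    refine ⟨fun x y => ?_⟩
    have hJ : Injective S.X₂ := ‹_›
    have key : ∀ z : Ext.{u} (ModuleCat.of Γ (Γ ⧸ I)) S.X₃ (n + 1), z = 0 := fun z => by
      obtain ⟨w, rfl⟩ := Ext.covariant_sequence_exact₃ _ hS z (n₁ := n + 2) rfl
        (Subsingleton.elim (α := Ext.{u} (ModuleCat.of Γ (Γ ⧸ I)) Z (n + 1 + 1)) _ _)
      rw [Ext.eq_zero_of_hasInjectiveDimensionLT w 1 (by lia), Ext.zero_comp]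
    rw [key x, key y]

/-- Over a left noetherian ring, the global dimension is at most two as soon as all kernels of
maps between finitely generated free modules are projective. -/
theorem gldim_le_two_of_projective_ker [IsNoetherianRing Γ]
    (h : ∀ (a b : ℕ) (f : (Fin a → Γ) →ₗ[Γ] (Fin b → Γ)), Module.Projective Γ (LinearMap.ker f)) :
    gldim Γ ≤ 2 := by
  -- Cyclic modules suffice: bounding their projective dimension by 2 kills `Ext³(Γ/I, Z)`, so every
  -- `Z` has injective dimension at most 2, and `Ext³(X, Z) = 0` for all `X`.
  have hcyc : ∀ I : Ideal Γ, HasProjectiveDimensionLE (ModuleCat.of Γ (Γ ⧸ I)) 2 := by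
    intro I
    obtain ⟨a, f, hf⟩ := Module.Finite.exists_fin' Γ I
    let e : Γ ≃ₗ[Γ] (Fin 1 → Γ) := (LinearEquiv.funUnique (Fin 1) Γ Γ).symm
    have h1 := h a 1 (e.toLinearMap ∘ₗ I.subtype ∘ₗ f)
    rw [LinearMap.ker_comp_of_ker_eq_bot _ e.ker, IsProjective.iff_projective,
      projective_iff_hasProjectiveDimensionLT_one,
      ← hasProjectiveDimensionLT_ker_iff _ 0,
      LinearMap.range_comp_of_range_eq_top _ (LinearMap.range_eq_top.2 hf),
      Submodule.range_subtype] at h1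
    have h2 := (hasProjectiveDimensionLT_ker_iff I.mkQ 1).2 (by rwa [Submodule.ker_mkQ])
    have h3 : LinearMap.range I.mkQ = ⊤ := Submodule.range_mkQ _
    exact hasProjectiveDimensionLT_of_iso
      ((LinearEquiv.ofTop _ h3).toModuleIso : ModuleCat.of Γ _ ≅ ModuleCat.of Γ (Γ ⧸ I)) 3
  have hinj : ∀ Z : ModuleCat.{u} Γ, HasInjectiveDimensionLE Z 2 := fun Z =>
    hasInjectiveDimensionLE_of_ext_quotient 2 Z fun I =>
      HasProjectiveDimensionLT.subsingleton _ 3 3 le_rfl Z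
  exact gldim_le_two_iff.2 fun X => HasProjectiveDimensionLT.mk fun i hi Y e => by
    exact e.eq_zero_of_hasInjectiveDimensionLT 3 hi

end Homological
-- Direct summands
section Retracts

/-- `X` is isomorphic to a direct summand of `Y`. -/
def IsRetract (Λ : Type*) [Ring Λ] (X Y : Type*) [AddCommGroup X] [Module Λ X] [AddCommGroup Y]
    [Module Λ Y] : Prop :=
  ∃ (ι : X →ₗ[Λ] Y) (π : Y →ₗ[Λ] X), ∀ x, π (ι x) = x

variable {Λ : Type*} [Ring Λ] {X Y Z : Type*} [AddCommGroup X] [Module Λ X] [AddCommGroup Y]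
  [Module Λ Y] [AddCommGroup Z] [Module Λ Z]

theorem IsRetract.trans (h : IsRetract Λ X Y) (h' : IsRetract Λ Y Z) : IsRetract Λ X Z := by
  obtain ⟨ι, π, h⟩ := h
  obtain ⟨ι', π', h'⟩ := h'
  exact ⟨ι' ∘ₗ ι, π ∘ₗ π', fun x => by simp [h, h']⟩

theorem IsRetract.of_equiv (e : X ≃ₗ[Λ] Y) : IsRetract Λ X Y :=
  ⟨e.toLinearMap, e.symm.toLinearMap, fun x => by simp⟩

theorem IsRetract.projective [Module.Projective Λ Y] (h : IsRetract Λ X Y) :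
    Module.Projective Λ X := by
  obtain ⟨ι, π, h⟩ := h
  exact Module.Projective.of_split ι π (LinearMap.ext h)

theorem IsRetract.finite [Module.Finite Λ Y] (h : IsRetract Λ X Y) : Module.Finite Λ X := by
  obtain ⟨ι, π, h⟩ := h
  exact Module.Finite.of_surjective π fun x => ⟨ι x, h x⟩

/-- A module with a retraction onto `X` splits as the product of `X` and the kernel. -/
def prodKerEquiv (ι : X →ₗ[Λ] Y) (π : Y →ₗ[Λ] X) (h : ∀ x, π (ι x) = x) :
    Y ≃ₗ[Λ] X × LinearMap.ker π where
  toFun y := (π y, ⟨y - ι (π y), by simp [h]⟩)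
  map_add' y z := by
    ext
    · simp
    · simp; abel
  map_smul' r y := by
    ext
    · simp
    · simp [smul_sub]
  invFun p := ι p.1 + p.2
  left_inv y := by simp
  right_inv p := by
    ext <;> simp [h]

end Retracts

/-! ### Decomposition into indecomposables and Krull–Schmidt -/

section KrullSchmidt

variable {Λ : Type u} [Ring Λ]

theorem subsingleton_or_of_indecomposable {X : ModuleCat.{u} Λ} (hX : Indecomposable X)
    {A B : Type u} [AddCommGroup A] [Module Λ A] [AddCommGroup B] [Module Λ B]
    (e : X ≃ₗ[Λ] A × B) : Subsingleton A ∨ Subsingleton B := by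
  have := hX.2 (ModuleCat.of Λ A) (ModuleCat.of Λ B)
    ((e.toModuleIso : X ≅ ModuleCat.of Λ (A × B)) ≪≫
      (ModuleCat.biprodIsoProd (ModuleCat.of Λ A) (ModuleCat.of Λ B)).symm)
  simpa [ModuleCat.isZero_iff_subsingleton] using this

theorem nontrivial_of_indecomposable {X : ModuleCat.{u} Λ} (hX : Indecomposable X) :
    Nontrivial X := by
  have := hX.1
  rwa [ModuleCat.isZero_iff_subsingleton, not_subsingleton_iff_nontrivial] at this

/-- Noetherian induction on `N` for the quotients `X / N`. If `X / N` splits as `Y × Z` with both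
factors nonzero, each factor is a quotient of `X` by a strictly larger submodule. -/
theorem noetherian_module_induction (P : ModuleCat.{u} Λ → Prop)
    (hiso : ∀ X Y : ModuleCat.{u} Λ, (X ≃ₗ[Λ] Y) → P X → P Y)
    (hzero : ∀ X : ModuleCat.{u} Λ, Subsingleton X → P X)
    (hind : ∀ X : ModuleCat.{u} Λ, Indecomposable X → P X)
    (hprod : ∀ A B : ModuleCat.{u} Λ, P A → P B → P (ModuleCat.of Λ (A × B)))
    (X : ModuleCat.{u} Λ) [IsNoetherian Λ X] : P X := by
  suffices h : ∀ N : Submodule Λ X, P (ModuleCat.of Λ (X ⧸ N)) from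
    hiso _ X (Submodule.quotEquivOfEqBot ⊥ rfl) (h ⊥)
  intro N
  induction N using IsNoetherian.induction with
  | hgt N ih =>
  by_cases h0 : Subsingleton (X ⧸ N)
  · exact hzero _ h0
  by_cases hi : Indecomposable (ModuleCat.of Λ (X ⧸ N))
  · exact hind _ hi
  have : ∃ Y Z : ModuleCat.{u} Λ, ∃ _ : ModuleCat.of Λ (X ⧸ N) ≅ Y ⊞ Z,
      Nontrivial Y ∧ Nontrivial Z := by
    simp only [Indecomposable, ModuleCat.isZero_iff_subsingleton] at hi
    push Not at hi
    obtain ⟨Y, Z, e, h⟩ := hi (not_subsingleton_iff_nontrivial.1 h0)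
    exact ⟨Y, Z, e, h⟩
  obtain ⟨Y, Z, i, hY, hZ⟩ := this
  let e : (X ⧸ N) ≃ₗ[Λ] Y × Z := (i ≪≫ ModuleCat.biprodIsoProd Y Z).toLinearEquiv
  -- A proper quotient `V` of `Y × Z` is `X / ker f` with `ker f` strictly above `N`, so the
  -- induction hypothesis applies.
  have key : ∀ (V : ModuleCat.{u} Λ) (p : (Y × Z) →ₗ[Λ] V), Function.Surjective p →
      (∃ w, w ≠ 0 ∧ p w = 0) → P V := by
    rintro V p hp ⟨w, hw, hpw⟩
    let f : X →ₗ[Λ] V := p ∘ₗ e.toLinearMap ∘ₗ N.mkQ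
    have hf : Function.Surjective f := by
      simpa [f] using hp.comp (e.surjective.comp (Submodule.mkQ_surjective N))
    refine hiso _ V (f.quotKerEquivOfSurjective hf) (ih _ ?_)
    refine lt_of_le_of_ne (fun x hx => ?_) fun h => ?_
    · have : N.mkQ x = 0 := by simpa using hx
      simp only [LinearMap.mem_ker, f, LinearMap.comp_apply, this, map_zero]
    · obtain ⟨x, hx⟩ := Submodule.mkQ_surjective N (e.symm w)
      have : x ∈ N := by
        rw [h]
        simp only [LinearMap.mem_ker, f, LinearMap.comp_apply, hx]
        simpa using hpw
      rw [← Submodule.ker_mkQ N, LinearMap.mem_ker, hx] at this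
      exact hw (by simpa using this)
  obtain ⟨y, hy⟩ := exists_ne (0 : Y)
  obtain ⟨z, hz⟩ := exists_ne (0 : Z)
  refine hiso _ _ e.symm (hprod Y Z (key Y (LinearMap.fst Λ Y Z) Prod.fst_surjective
    ⟨(0, z), by simpa using hz, by simp⟩) (key Z (LinearMap.snd Λ Y Z) Prod.snd_surjective
    ⟨(y, 0), by simpa using hy, by simp⟩))

theorem exists_isUnit_of_isUnit_sum {A ι : Type*} [Ring A] [IsLocalRing A] (s : Finset ι)
    (f : ι → A) (h : IsUnit (∑ i ∈ s, f i)) : ∃ i ∈ s, IsUnit (f i) := by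
  classical
  induction s using Finset.induction_on with
  | empty => simp at h
  | insert a s ha ih =>
    rw [Finset.sum_insert ha] at h
    obtain ⟨v, hv⟩ := h
    have h1 : (↑v⁻¹ : A) * f a + ↑v⁻¹ * ∑ i ∈ s, f i = 1 := by
      rw [← mul_add, ← hv, Units.inv_mul]
    rcases IsLocalRing.isUnit_or_isUnit_of_add_one h1 with h2 | h2
    · exact ⟨a, by simp, (Units.isUnit_units_mul _ _).1 h2⟩
    · obtain ⟨i, hi, h3⟩ := ih ((Units.isUnit_units_mul _ _).1 h2)
      exact ⟨i, by simp [hi], h3⟩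

theorem isRetract_of_isUnit {Λ X Y : Type*} [Ring Λ] [AddCommGroup X] [Module Λ X]
    [AddCommGroup Y] [Module Λ Y] {ι : X →ₗ[Λ] Y} {π : Y →ₗ[Λ] X}
    (h : IsUnit (π ∘ₗ ι : Module.End Λ X)) : IsRetract Λ X Y := by
  obtain ⟨v, hv⟩ := h
  refine ⟨ι, (↑v⁻¹ : Module.End Λ X) ∘ₗ π, fun x => ?_⟩
  have := congr($(v.inv_mul) x)
  rw [hv] at this
  exact this

/-- The identity of `X` is the sum of its factorizations through the `Y i`; in a local ring one
summand is a unit. -/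
theorem IsRetract.exists_of_pi {Λ X : Type*} [Ring Λ] [AddCommGroup X] [Module Λ X]
    [IsLocalRing (Module.End Λ X)] {ι : Type*} [Fintype ι] {Y : ι → Type*}
    [∀ i, AddCommGroup (Y i)] [∀ i, Module Λ (Y i)] (h : IsRetract Λ X (∀ i, Y i)) :
    ∃ i, IsRetract Λ X (Y i) := by
  classical
  obtain ⟨j, π, h⟩ := h
  have h1 : ∑ i, ((π ∘ₗ LinearMap.single Λ Y i) ∘ₗ (LinearMap.proj i ∘ₗ j) : Module.End Λ X)
      = 1 := by
    ext x
    simp only [LinearMap.sum_apply, LinearMap.comp_apply, ← map_sum]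
    rw [Module.End.one_apply]
    conv_rhs => rw [← h x]
    congr 1
    simpa using Finset.univ_sum_single (j x)
  obtain ⟨i, -, hi⟩ := exists_isUnit_of_isUnit_sum _ _ (h1 ▸ isUnit_one)
  exact ⟨i, isRetract_of_isUnit hi⟩

theorem IsRetract.or_of_prod {Λ X A B : Type*} [Ring Λ] [AddCommGroup X] [Module Λ X]
    [IsLocalRing (Module.End Λ X)] [AddCommGroup A] [Module Λ A] [AddCommGroup B] [Module Λ B]
    (h : IsRetract Λ X (A × B)) : IsRetract Λ X A ∨ IsRetract Λ X B := by
  obtain ⟨j, π, h⟩ := h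
  have h1 : (π ∘ₗ LinearMap.inl Λ A B) ∘ₗ (LinearMap.fst Λ A B ∘ₗ j) +
      (π ∘ₗ LinearMap.inr Λ A B) ∘ₗ (LinearMap.snd Λ A B ∘ₗ j) = (1 : Module.End Λ X) := by
    ext x
    simp [← map_add, h]
  exact (IsLocalRing.isUnit_or_isUnit_of_add_one h1).imp isRetract_of_isUnit isRetract_of_isUnit

/-- Krull–Schmidt: a noetherian module has, up to isomorphism, only finitely many indecomposable
direct summands with local endomorphism ring. -/
theorem finite_indecomposable_retracts (M : ModuleCat.{u} Λ) [IsNoetherian Λ M] :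
    (ind fun X : ModuleCat.{u} Λ => IsLocalRing (Module.End Λ X) ∧ IsRetract Λ X M).Finite := by
  refine noetherian_module_induction
    (fun M => (ind fun X : ModuleCat.{u} Λ => IsLocalRing (Module.End Λ X) ∧
      IsRetract Λ X M).Finite) ?_ ?_ ?_ ?_ M
  · rintro X Y e h
    refine h.subset ?_
    rintro _ ⟨Z, ⟨h1, h2⟩, h3, rfl⟩
    exact ⟨Z, ⟨h1, h2.trans (.of_equiv e.symm)⟩, h3, rfl⟩
  · rintro X h
    convert Set.finite_empty
    refine Set.eq_empty_of_forall_notMem ?_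
    rintro _ ⟨Z, ⟨h1, ι, π, h2⟩, h3, rfl⟩
    have := nontrivial_of_indecomposable h3
    exact not_subsingleton Z (Function.LeftInverse.injective h2).subsingleton
  · rintro X h
    refine (Set.finite_singleton (Quotient.mk _ X)).subset ?_
    rintro _ ⟨Z, ⟨h1, ι, π, h2⟩, h3, rfl⟩
    have := nontrivial_of_indecomposable h3
    let e := prodKerEquiv ι π h2
    have : Subsingleton (LinearMap.ker π) :=
      (subsingleton_or_of_indecomposable h e).resolve_left (not_subsingleton Z)
    have hb : Function.Bijective π := ⟨by
      rw [← LinearMap.ker_eq_bot]; exact Submodule.subsingleton_iff_eq_bot.1 this,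
      fun z => ⟨ι z, h2 z⟩⟩
    exact Quotient.sound ⟨(LinearEquiv.ofBijective π hb).symm.toModuleIso⟩
  · rintro A B hA hB
    refine (hA.union hB).subset ?_
    rintro _ ⟨Z, ⟨h1, h2⟩, h3, rfl⟩
    exact h2.or_of_prod.imp (fun h => ⟨Z, ⟨h1, h⟩, h3, rfl⟩) (fun h => ⟨Z, ⟨h1, h⟩, h3, rfl⟩)

end KrullSchmidt

/-! ### Locality of endomorphism rings over a complete base -/

section LocalEndomorphismRings

theorem finite_linearMap {R Λ X Y : Type*} [CommRing R] [IsNoetherianRing R] [Ring Λ]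
    [Algebra R Λ] [AddCommGroup X] [Module Λ X] [Module R X] [IsScalarTower R Λ X]
    [Module.Finite R X] [AddCommGroup Y] [Module Λ Y] [Module R Y] [IsScalarTower R Λ Y]
    [Module.Finite R Y] : Module.Finite R (X →ₗ[Λ] Y) := by
  obtain ⟨n, s, hs⟩ := Module.Finite.exists_fin (R := R) (M := X)
  let φ : (X →ₗ[Λ] Y) →ₗ[R] (Fin n → Y) :=
    { toFun := fun f i => f (s i)
      map_add' := fun _ _ => rfl
      map_smul' := fun _ _ => rfl }
  refine Module.Finite.of_injective φ fun f g h => ?_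
  have : f.restrictScalars R = g.restrictScalars R := by
    refine LinearMap.ext_on_range hs fun i => congrFun h i
  exact LinearMap.ext fun x => congr($this x)

/-- For finite modules over a noetherian ring, completion is base change to the completed ring,
which here is `R` itself. -/
theorem isAdicComplete_of_finite {R : Type u} [CommRing R] [IsNoetherianRing R] (J : Ideal R)
    [IsAdicComplete J R] (M : Type u) [AddCommGroup M] [Module R M] [Module.Finite R M] :
    IsAdicComplete J M := by
  rw [← AdicCompletion.of_bijective_iff]
  have h1 := AdicCompletion.ofTensorProduct_bijective_of_finite_of_isNoetherian J M
  let e : M ≃ₗ[R] AdicCompletion J R ⊗[R] M :=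
    (TensorProduct.lid R M).symm.trans
      (LinearEquiv.rTensor M (AdicCompletion.ofLinearEquiv J R))
  have h2 : ⇑(AdicCompletion.of J M) = AdicCompletion.ofTensorProduct J M ∘ e := by
    ext1 x
    simp only [e, Function.comp_apply, LinearEquiv.trans_apply, TensorProduct.lid_symm_apply,
      LinearEquiv.rTensor_tmul, AdicCompletion.ofTensorProduct_tmul,
      AdicCompletion.ofLinearEquiv_apply]
    exact (one_smul (AdicCompletion J R) _).symm
  rw [h2]
  exact h1.comp e.bijective

/-- Fitting's lemma modulo `J`, lifted by Hensel. In the artinian quotient the powers of `f`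
stabilize and produce an idempotent; it lifts as a root of `X² - X`. Units lift because `J` lies in
the Jacobson radical. -/
theorem exists_idempotent_of_henselian {B : Type*} [CommRing B] (J : Ideal B) [HenselianRing B J]
    [IsArtinianRing (B ⧸ J)] (f : B) :
    ∃ e : B, e * e = e ∧ (e = 1 → IsUnit f) ∧ (e = 0 → IsUnit (1 - f)) := by
  have hloc : ∀ x : B, IsUnit (Ideal.Quotient.mk J x) → IsUnit x := fun x hx =>
    (isLocalHom_of_le_jacobson_bot J HenselianRing.jac).map_nonunit x hx
  obtain ⟨n, y, hy⟩ := IsArtinian.exists_pow_succ_smul_dvd (M := B ⧸ J)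
    (Ideal.Quotient.mk J f) 1
  simp only [smul_eq_mul, mul_one] at hy
  have hk : ∀ k, (Ideal.Quotient.mk J f) ^ (n + k) * y ^ k = (Ideal.Quotient.mk J f) ^ n := by
    intro k
    induction k with
    | zero => simp
    | succ k ih =>
      rw [Nat.succ_eq_add_one] at hy
      linear_combination (Ideal.Quotient.mk J f) ^ k * y ^ k * hy + ih
  obtain ⟨c, hc⟩ := Ideal.Quotient.mk_surjective (y ^ n)
  -- Modulo `J` this is `f^n y^n`, which is idempotent because `f^(2n) y^n = f^n`.
  set e₀ := f ^ n * c with he₀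
  have h0 : Ideal.Quotient.mk J (e₀ * e₀) = Ideal.Quotient.mk J e₀ := by
    simp only [he₀, map_mul, map_pow, hc]
    linear_combination y ^ n * hk n
  let p : Polynomial B := Polynomial.X ^ 2 - Polynomial.X
  have hp : p.Monic := by
    apply Polynomial.monic_X_pow_sub
    exact Polynomial.degree_X_le.trans_lt (by norm_num)
  obtain ⟨e, he, hee⟩ := HenselianRing.is_henselian (I := J) p hp e₀
    (by
      rw [← Ideal.Quotient.eq_zero_iff_mem]
      simp only [p, Polynomial.eval_sub, Polynomial.eval_pow, Polynomial.eval_X, map_sub,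
        pow_two e₀, h0, sub_self])
    (by
      -- The derivative `2e₀ - 1` is its own inverse modulo `J`, as `(2e₀ - 1)² = 4(e₀² - e₀) + 1`.
      refine isUnit_iff_exists_inv.2 ⟨Ideal.Quotient.mk J (2 * e₀ - 1), ?_⟩
      simp only [p, Polynomial.derivative_sub, Polynomial.derivative_X_pow,
        Polynomial.derivative_X, Polynomial.eval_sub, Polynomial.eval_mul, Polynomial.eval_one,
        Polynomial.eval_pow, Polynomial.eval_X, Nat.cast_ofNat, Polynomial.eval_C]
      rw [map_mul] at h0
      simp only [map_sub, map_mul, map_ofNat, map_one, map_pow]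
      linear_combination 4 * h0)
  rw [← Ideal.Quotient.eq_zero_iff_mem, map_sub, sub_eq_zero] at hee
  refine ⟨e, ?_, ?_, ?_⟩
  · simp only [p, Polynomial.IsRoot, Polynomial.eval_sub, Polynomial.eval_pow,
      Polynomial.eval_X] at he
    linear_combination he
  · rintro rfl
    refine hloc f ?_
    -- For `n = 0` the power `f^n` says nothing about `f`, but then `hy` reads `f y = 1`.
    rcases n.eq_zero_or_pos with rfl | hn
    · exact isUnit_iff_exists_inv.2 ⟨y, by simpa using hy⟩
    · have : IsUnit (Ideal.Quotient.mk J f ^ n) :=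
        isUnit_iff_exists_inv.2 ⟨Ideal.Quotient.mk J c, by
          rw [← map_pow, ← map_mul, ← he₀, ← hee, map_one]⟩
      exact (isUnit_pow_iff hn.ne').1 this
  · rintro rfl
    refine hloc _ ?_
    have : Ideal.Quotient.mk J f ^ n = 0 := by
      rw [map_zero, he₀, map_mul, hc, map_pow] at hee
      rw [← hk n, pow_add]
      linear_combination -(Ideal.Quotient.mk J f ^ n) * hee
    rw [map_sub, map_one]
    exact IsNilpotent.isUnit_one_sub ⟨n, this⟩

theorem exists_idempotent_of_finite {R B : Type u} [CommRing R] [IsNoetherianRing R]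
    (J : Ideal R) [IsAdicComplete J R] [IsArtinianRing (R ⧸ J)] [CommRing B] [Algebra R B]
    [Module.Finite R B] (f : B) :
    ∃ e : B, e * e = e ∧ (e = 1 → IsUnit f) ∧ (e = 0 → IsUnit (1 - f)) := by
  have := (IsAdicComplete.map_algebraMap_iff (S := B) J B).2 (isAdicComplete_of_finite J B)
  have : Module.Finite (R ⧸ J) (B ⧸ J.map (algebraMap R B)) :=
    Module.Finite.of_restrictScalars_finite R (R ⧸ J) (B ⧸ J.map (algebraMap R B))
  have := IsArtinianRing.of_finite (R ⧸ J) (B ⧸ J.map (algebraMap R B))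
  exact exists_idempotent_of_henselian (J.map (algebraMap R B)) f

/-- Over an algebra whose base ring is complete with respect to an ideal with artinian quotient,
an indecomposable module which is finitely generated over the base has local endomorphism ring. -/
theorem isLocalRing_end_of_indecomposable {R : Type*} [CommRing R] [IsNoetherianRing R]
    (J : Ideal R) [IsAdicComplete J R] [IsArtinianRing (R ⧸ J)] {Λ : Type u} [Ring Λ]
    [Algebra R Λ] (X : ModuleCat.{u} Λ) [Module R X] [IsScalarTower R Λ X] [Module.Finite R X]
    (hX : Indecomposable X) : IsLocalRing (Module.End Λ X) := by
  have := nontrivial_of_indecomposable hX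
  -- An idempotent splits `X` into its range and its kernel, one of which vanishes.
  have hidem : ∀ e : Module.End Λ X, e * e = e → e = 0 ∨ e = 1 := by
    intro e he
    have he' : ∀ x, e (e x) = e x := fun x => congr($he x)
    have h1 : ∀ x : LinearMap.range e, e.rangeRestrict ((LinearMap.range e).subtype x) = x := by
      rintro ⟨_, x, rfl⟩
      exact Subtype.ext (he' x)
    rcases subsingleton_or_of_indecomposable hX
      (prodKerEquiv (LinearMap.range e).subtype e.rangeRestrict h1) with h | h
    · left
      exact LinearMap.range_eq_bot.1 (Submodule.subsingleton_iff_eq_bot.1 h)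
    · right
      ext x
      have h2 : x - e x ∈ LinearMap.ker e.rangeRestrict := by
        simp [he']
      rw [Submodule.subsingleton_iff_eq_bot.1 h, Submodule.mem_bot, sub_eq_zero] at h2
      exact h2.symm
  refine IsLocalRing.of_isUnit_or_isUnit_one_sub_self fun f => ?_
  have hfin : Module.Finite R (Module.End Λ X) := finite_linearMap
  -- `End_Λ(X)` need not be commutative, so Hensel's lemma is applied in the commutative subalgebra
  -- `R[f]`, which is finite over `R`.
  let φ : Polynomial R →ₐ[R] Module.End Λ X := Polynomial.aeval f
  let B := Polynomial R ⧸ RingHom.ker φ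
  let ψ : B →ₐ[R] Module.End Λ X := Ideal.kerLiftAlg φ
  have hψ : Function.Injective ψ := Ideal.kerLiftAlg_injective φ
  have : Module.Finite R B := Module.Finite.of_injective ψ.toLinearMap hψ
  obtain ⟨e, he, h1, h0⟩ := exists_idempotent_of_finite J (Ideal.Quotient.mk _ Polynomial.X : B)
  have hf : ψ (Ideal.Quotient.mk _ Polynomial.X : B) = f := by
    exact Polynomial.aeval_X f
  rcases hidem (ψ e) (by rw [← map_mul, he]) with h | h
  · right
    have := (h0 (hψ (by rw [h, map_zero]))).map ψ
    rwa [map_sub, hf, map_one] at this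
  · left
    have := (h1 (hψ (by rw [h, map_one]))).map ψ
    rwa [hf] at this

end LocalEndomorphismRings
-- Projectivization: kernels over `End_Λ(M)` and kernels in `mod Λ`
section HomModules

/-- `Hom_Λ(M, N)`, regarded as a left module over `End_Λ(M)`. -/
def HomMod (Λ : Type*) [Ring Λ] (M N : Type*) [AddCommGroup M] [Module Λ M] [AddCommGroup N]
    [Module Λ N] : Type _ := M →ₗ[Λ] N

variable {Λ : Type u} [Ring Λ] {M : Type u} [AddCommGroup M] [Module Λ M]
  {N : Type*} [AddCommGroup N] [Module Λ N] {K : Type*} [AddCommGroup K] [Module Λ K]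

instance : AddCommGroup (HomMod Λ M N) := inferInstanceAs (AddCommGroup (M →ₗ[Λ] N))

instance : FunLike (HomMod Λ M N) M N := inferInstanceAs (FunLike (M →ₗ[Λ] N) M N)

instance : LinearMapClass (HomMod Λ M N) Λ M N :=
  inferInstanceAs (LinearMapClass (M →ₗ[Λ] N) Λ M N)

@[ext] theorem HomMod.ext {f g : HomMod Λ M N} (h : ∀ m, f m = g m) : f = g :=
  LinearMap.ext (f := (f : M →ₗ[Λ] N)) (g := g) h

@[simp] theorem HomMod.add_apply (f g : HomMod Λ M N) (m : M) : (f + g) m = f m + g m := rfl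

@[simp] theorem HomMod.zero_apply (m : M) : (0 : HomMod Λ M N) m = 0 := rfl

instance : Module (EndRing Λ M) (HomMod Λ M N) where
  smul a f := LinearMap.comp (f : M →ₗ[Λ] N) (a.unop : M →ₗ[Λ] M)
  one_smul _ := rfl
  mul_smul _ _ _ := rfl
  smul_zero _ := rfl
  smul_add _ _ _ := rfl
  add_smul a b f := HomMod.ext fun m => map_add f (a.unop m) (b.unop m)
  zero_smul f := HomMod.ext fun _ => map_zero f

@[simp] theorem HomMod.smul_apply (a : EndRing Λ M) (f : HomMod Λ M N) (m : M) :
    (a • f) m = f (a.unop m) := rfl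

theorem HomMod.sum_apply {ι : Type*} (s : Finset ι) (f : ι → HomMod Λ M N) (m : M) :
    (∑ i ∈ s, f i) m = ∑ i ∈ s, f i m :=
  LinearMap.sum_apply s f m

/-- Composition with a `Λ`-linear map. -/
def HomMod.map (g : N →ₗ[Λ] K) : HomMod Λ M N →ₗ[EndRing Λ M] HomMod Λ M K where
  toFun f := g ∘ₗ (f : M →ₗ[Λ] N)
  map_add' f f' := HomMod.ext fun m => map_add g (f m) (f' m)
  map_smul' _ _ := rfl

@[simp] theorem HomMod.map_apply (g : N →ₗ[Λ] K) (f : HomMod Λ M N) (m : M) :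
    HomMod.map g f m = g (f m) := rfl

variable (Λ M) in
/-- `Hom_Λ(M, M)` is the regular `End_Λ(M)`-module. -/
def HomMod.selfEquiv : HomMod Λ M M ≃ₗ[EndRing Λ M] EndRing Λ M where
  toFun f := MulOpposite.op f
  invFun a := a.unop
  map_add' _ _ := rfl
  map_smul' _ _ := rfl
  left_inv _ := rfl
  right_inv _ := rfl

theorem HomMod.isRetract_map (h : IsRetract Λ K N) :
    IsRetract (EndRing Λ M) (HomMod Λ M K) (HomMod Λ M N) := by
  obtain ⟨ι, π, h⟩ := h
  exact ⟨HomMod.map ι, HomMod.map π, fun f => HomMod.ext fun m => h (f m)⟩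

theorem HomMod.isRetract_pi {k : ℕ} (h : IsRetract Λ K (Fin k → N)) :
    IsRetract (EndRing Λ M) (HomMod Λ M K) (Fin k → HomMod Λ M N) := by
  refine (HomMod.isRetract_map h).trans ⟨LinearMap.pi fun i => HomMod.map (LinearMap.proj i),
    ∑ i, HomMod.map (LinearMap.single Λ (fun _ : Fin k => N) i) ∘ₗ LinearMap.proj i, fun f => ?_⟩
  ext1 m
  rw [LinearMap.sum_apply, HomMod.sum_apply]
  exact Finset.univ_sum_single (f m)

/-- The map `M^a → M^b` given by the same matrix as a map `End(M)^a → End(M)^b`. -/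
def matHom {a b : ℕ} (U : (Fin a → EndRing Λ M) →ₗ[EndRing Λ M] (Fin b → EndRing Λ M)) :
    (Fin a → M) →ₗ[Λ] (Fin b → M) :=
  LinearMap.pi fun j => ∑ i, (U (Pi.single i 1) j).unop ∘ₗ LinearMap.proj i

theorem unop_apply_eq_matHom {a b : ℕ}
    (U : (Fin a → EndRing Λ M) →ₗ[EndRing Λ M] (Fin b → EndRing Λ M))
    (x : Fin a → EndRing Λ M) (j : Fin b) (m : M) :
    (U x j).unop m = matHom U (fun i => (x i).unop m) j := by
  conv_lhs => rw [← Finset.univ_sum_single x]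
  have h : ∀ i, U (Pi.single i (x i)) = x i • U (Pi.single i 1) := fun i => by
    rw [← map_smul, ← Pi.single_smul, smul_eq_mul, mul_one]
  simp only [map_sum, h, Finset.sum_apply, Finset.unop_sum, LinearMap.sum_apply, matHom,
    LinearMap.pi_apply, LinearMap.comp_apply, LinearMap.proj_apply]
  rfl

/-- The kernel of a matrix over `End_Λ(M)` is `Hom_Λ(M, -)` of the kernel of the corresponding map
between powers of `M`. -/
def kerEquivHomMod {a b : ℕ}
    (U : (Fin a → EndRing Λ M) →ₗ[EndRing Λ M] (Fin b → EndRing Λ M)) :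
    LinearMap.ker U ≃ₗ[EndRing Λ M] HomMod Λ M (LinearMap.ker (matHom U)) where
  toFun x := LinearMap.codRestrict _ (LinearMap.pi fun i => (x.1 i).unop) fun m => by
    rw [LinearMap.mem_ker]
    ext j
    have := unop_apply_eq_matHom U x.1 j m
    rw [LinearMap.mem_ker.1 x.2] at this
    exact this.symm
  map_add' x y := rfl
  map_smul' r x := rfl
  invFun f := ⟨fun i => MulOpposite.op (LinearMap.proj i ∘ₗ Submodule.subtype _ ∘ₗ
      (f : M →ₗ[Λ] LinearMap.ker (matHom U))), by
    rw [LinearMap.mem_ker]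
    ext j
    refine MulOpposite.unop_injective (LinearMap.ext fun m => ?_)
    rw [unop_apply_eq_matHom]
    exact congrFun (LinearMap.mem_ker.1 (f m).2) j⟩
  left_inv x := rfl
  right_inv f := rfl

theorem isRetract_ker_of_isRetract_ker_matHom {a b k : ℕ}
    (U : (Fin a → EndRing Λ M) →ₗ[EndRing Λ M] (Fin b → EndRing Λ M))
    (h : IsRetract Λ (LinearMap.ker (matHom U)) (Fin k → N)) :
    IsRetract (EndRing Λ M) (LinearMap.ker U) (Fin k → HomMod Λ M N) :=
  (IsRetract.of_equiv (kerEquivHomMod U)).trans (HomMod.isRetract_pi h)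

theorem projective_ker_of_isRetract_ker_matHom {a b k : ℕ}
    (U : (Fin a → EndRing Λ M) →ₗ[EndRing Λ M] (Fin b → EndRing Λ M))
    (h : IsRetract Λ (LinearMap.ker (matHom U)) (Fin k → M)) :
    Module.Projective (EndRing Λ M) (LinearMap.ker U) :=
  ((isRetract_ker_of_isRetract_ker_matHom U h).trans (.of_equiv
    (LinearEquiv.piCongrRight fun _ => HomMod.selfEquiv Λ M))).projective

/-- If `M` is a generator, a module `K` with `Hom_Λ(M, K)` finitely generated projective over
`End_Λ(M)` is a direct summand of a power of `M`. -/
theorem exists_isRetract_of_projective_homMod (hM : IsRetract Λ Λ M)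
    [Module.Finite (EndRing Λ M) (HomMod Λ M K)] [Module.Projective (EndRing Λ M) (HomMod Λ M K)] :
    ∃ k : ℕ, IsRetract Λ K (Fin k → M) := by
  obtain ⟨ι, π, hιπ⟩ := hM
  obtain ⟨k, p, hp⟩ := Module.Finite.exists_fin' (EndRing Λ M) (HomMod Λ M K)
  obtain ⟨s, hs⟩ := Module.projective_lifting_property p LinearMap.id hp
  have hs' : ∀ f, p (s f) = f := fun f => congr($hs f)
  -- `φ x` is `m ↦ π(m) x`, and `x` is recovered by evaluation at `ι 1`. The map is semilinear along
  -- the multiplicative, possibly non-unital `ρ`.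
  let φ : K → HomMod Λ M K := fun x => LinearMap.toSpanSingleton Λ K x ∘ₗ π
  have hφ : ∀ x m, φ x m = π m • x := fun _ _ => rfl
  let ρ : Λ → EndRing Λ M := fun r =>
    MulOpposite.op (ι ∘ₗ LinearMap.toSpanSingleton Λ Λ r ∘ₗ π)
  have hρ : ∀ r m, (ρ r).unop m = ι (π m * r) := fun _ _ => rfl
  have hφadd : ∀ x y, φ (x + y) = φ x + φ y := fun x y => HomMod.ext fun m => by
    simp [hφ]
  have hφsmul : ∀ r x, φ (r • x) = ρ r • φ x := fun r x => HomMod.ext fun m => by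
    simp [hφ, hρ, hιπ, mul_smul]
  -- Apply the splitting `s` to `φ x` and evaluate the coordinates at `ι 1`; the images under `p` of
  -- the basis vectors give the map back.
  refine ⟨k, { toFun := fun x i => (s (φ x) i).unop (ι 1)
               map_add' := fun x y => ?_
               map_smul' := fun r x => ?_ },
    ∑ i, ((p (Pi.single i 1) : HomMod Λ M K) : M →ₗ[Λ] K) ∘ₗ LinearMap.proj i, fun x => ?_⟩
  · ext i
    simp [hφadd]
  · ext i
    simp [hφsmul, hρ, hιπ, ← map_smul]
  · have h1 : ∀ y : Fin k → EndRing Λ M, p y = ∑ i, y i • p (Pi.single i 1) := fun y => by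
      conv_lhs => rw [← Finset.univ_sum_single y]
      rw [map_sum]
      refine Finset.sum_congr rfl fun i _ => ?_
      rw [← map_smul, ← Pi.single_smul, smul_eq_mul, mul_one]
    have h2 : φ x (ι 1) = x := by rw [hφ, hιπ, one_smul]
    conv_rhs => rw [← h2, ← hs' (φ x), h1, HomMod.sum_apply]
    rw [LinearMap.sum_apply]
    rfl

/-- Global dimension at most 2 makes `ker U ≅ Hom(M, ker (matHom U))` projective, and `M` is a
generator. -/
theorem exists_isRetract_ker_matHom (hM : IsRetract Λ Λ M) [IsNoetherianRing (EndRing Λ M)]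
    (h : gldim (EndRing Λ M) ≤ 2) {a b : ℕ}
    (U : (Fin a → EndRing Λ M) →ₗ[EndRing Λ M] (Fin b → EndRing Λ M)) :
    ∃ k : ℕ, IsRetract Λ (LinearMap.ker (matHom U)) (Fin k → M) := by
  have := projective_ker_of_gldim_le_two h U
  have := Module.Projective.of_equiv (kerEquivHomMod U)
  have := Module.Finite.equiv (kerEquivHomMod U)
  exact exists_isRetract_of_projective_homMod hM

/-- Every map between powers of `M` comes from a matrix over `End_Λ(M)`. -/
theorem exists_matHom_eq {a b : ℕ} (u : (Fin a → M) →ₗ[Λ] (Fin b → M)) :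
    ∃ U : (Fin a → EndRing Λ M) →ₗ[EndRing Λ M] (Fin b → EndRing Λ M), matHom U = u := by
  let U : (Fin a → EndRing Λ M) →ₗ[EndRing Λ M] (Fin b → EndRing Λ M) :=
    LinearMap.pi fun j => ∑ i, LinearMap.toSpanSingleton _ _ (MulOpposite.op
      (LinearMap.proj j ∘ₗ u ∘ₗ LinearMap.single Λ (fun _ => M) i) : EndRing Λ M) ∘ₗ
      LinearMap.proj i
  have hU : ∀ i j, U (Pi.single i 1) j = MulOpposite.op
      (LinearMap.proj j ∘ₗ u ∘ₗ LinearMap.single Λ (fun _ => M) i) := by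
    intro i j
    simp only [U, LinearMap.pi_apply, LinearMap.sum_apply, LinearMap.comp_apply,
      LinearMap.proj_apply, LinearMap.toSpanSingleton_apply]
    rw [Finset.sum_eq_single i]
    · simp
    · intro i' _ hi'
      simp [Pi.single_eq_of_ne hi']
    · simp
  refine ⟨U, LinearMap.ext fun m => funext fun j => ?_⟩
  conv_rhs => rw [← Finset.univ_sum_single m]
  simp only [matHom, LinearMap.pi_apply, LinearMap.sum_apply, LinearMap.comp_apply,
    LinearMap.proj_apply, hU, MulOpposite.unop_op, map_sum, Finset.sum_apply]
  rfl

end HomModules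

/-! ### Kernels of maps between powers of a module -/

section KernelClass

/-- `X` is isomorphic to the kernel of a map `A^n → A^m`. -/
def IsFreeKernel (A : Type*) [Ring A] (V X : Type*) [AddCommGroup V] [Module A V] [AddCommGroup X]
    [Module A X] : Prop :=
  ∃ (n m : ℕ) (f : (Fin n → V) →ₗ[A] (Fin m → V)), Nonempty (X ≃ₗ[A] LinearMap.ker f)

variable {A : Type*} [Ring A] {V W X P Q : Type*} [AddCommGroup V] [Module A V]
  [AddCommGroup W] [Module A W] [AddCommGroup X]
  [Module A X] [AddCommGroup P] [Module A P] [AddCommGroup Q] [Module A Q]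

theorem IsFreeKernel.of_equiv {Y : Type*} [AddCommGroup Y] [Module A Y] (e : X ≃ₗ[A] Y)
    (h : IsFreeKernel A V Y) : IsFreeKernel A V X := by
  obtain ⟨n, m, f, ⟨e'⟩⟩ := h
  exact ⟨n, m, f, ⟨e.trans e'⟩⟩

/-- The kernel of a map between direct summands of powers of `V` is the kernel of a map between
powers of `V`. -/
theorem isFreeKernel_ker {a b : ℕ} (hP : IsRetract A P (Fin a → V))
    (hQ : IsRetract A Q (Fin b → V)) (f : P →ₗ[A] Q) :
    IsFreeKernel A V (LinearMap.ker f) := by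
  obtain ⟨ι, π, h⟩ := hP
  obtain ⟨ι', π', h'⟩ := hQ
  -- The component `1 - ιπ` cuts out the image of `P` in `V^a`; the other one imposes `f = 0` there.
  let g : (Fin a → V) →ₗ[A] (Fin a → V) × (Fin b → V) :=
    LinearMap.prod (LinearMap.id - ι ∘ₗ π) (ι' ∘ₗ f ∘ₗ π)
  let e : ((Fin a → V) × (Fin b → V)) ≃ₗ[A] (Fin (a + b) → V) :=
    (LinearEquiv.sumArrowLequivProdArrow (Fin a) (Fin b) A V).symm.trans
      (LinearEquiv.funCongrLeft A V finSumFinEquiv.symm)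
  have hg : ∀ x, x ∈ LinearMap.ker (e.toLinearMap ∘ₗ g) ↔ x = ι (π x) ∧ f (π x) = 0 := by
    intro x
    rw [LinearMap.ker_comp_of_ker_eq_bot _ e.ker, LinearMap.mem_ker]
    have : g x = (x - ι (π x), ι' (f (π x))) := rfl
    rw [this, Prod.mk_eq_zero, sub_eq_zero]
    refine and_congr_right fun _ => ⟨fun h0 => ?_, fun h0 => by rw [h0, map_zero]⟩
    rw [← h' (f (π x)), h0, map_zero]
  refine ⟨a, a + b, e.toLinearMap ∘ₗ g, ⟨?_⟩⟩
  refine LinearEquiv.ofLinearMap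
    (LinearMap.codRestrict _ (ι ∘ₗ (LinearMap.ker f).subtype) fun x => by
      rw [hg]
      have := LinearMap.mem_ker.1 x.2
      simp [h, this])
    (LinearMap.codRestrict _ (π ∘ₗ (LinearMap.ker (e.toLinearMap ∘ₗ g)).subtype) fun x => by
      rw [LinearMap.mem_ker]
      exact ((hg x.1).1 x.2).2) ?_ ?_
  · ext x
    exact congrFun ((hg x.1).1 x.2).1.symm _
  · ext x
    simp [h]

theorem IsFreeKernel.of_isRetract {a : ℕ} (hV : IsRetract A V (Fin a → W))
    (h : IsFreeKernel A V X) : IsFreeKernel A W X := by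
  obtain ⟨n, m, f, ⟨e⟩⟩ := h
  have key : ∀ n : ℕ, ∃ b, IsRetract A (Fin n → V) (Fin b → W) := fun n => by
    obtain ⟨ι, π, h⟩ := hV
    refine ⟨n * a, IsRetract.trans (Y := Fin n → Fin a → W)
      ⟨LinearMap.pi fun i => ι ∘ₗ LinearMap.proj i, LinearMap.pi fun i => π ∘ₗ LinearMap.proj i,
        fun x => funext fun i => h (x i)⟩ (.of_equiv
        ((LinearEquiv.curry A W (Fin n) (Fin a)).symm.trans
          (LinearEquiv.funCongrLeft A W finProdFinEquiv.symm)))⟩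
  obtain ⟨b, hb⟩ := key n
  obtain ⟨c, hc⟩ := key m
  exact (isFreeKernel_ker hb hc f).of_equiv e

end KernelClass

/-! ### Reflexive modules as kernels between free modules -/

section Reflexive

variable {Λ : Type u} [Ring Λ]

theorem isReflexive_iff (X : ModuleCat.{u} Λ) :
    IsReflexive X ↔ (∀ x : X, (∀ f : X →ₗ[Λ] Λ, f x = 0) → x = 0) ∧
      ∀ φ : (X →ₗ[Λ] Λ) →ₗ[Λᵐᵒᵖ] Λ, ∃ x : X, ∀ f, φ f = f x := by
  refine and_congr ⟨fun h x hx => h (LinearMap.ext fun f => ?_), fun h x y hxy => ?_⟩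
    ⟨fun h φ => ?_, fun h φ => ?_⟩
  · exact (hx f).trans (map_zero f).symm
  · refine sub_eq_zero.1 (h _ fun f => ?_)
    rw [map_sub, sub_eq_zero]
    exact congr($hxy f)
  · obtain ⟨x, rfl⟩ := h φ
    exact ⟨x, fun _ => rfl⟩
  · obtain ⟨x, hx⟩ := h φ
    exact ⟨x, LinearMap.ext fun f => (hx f).symm⟩

/-- The dual of a linear map. -/
def dualMap {X Y : Type*} [AddCommGroup X] [Module Λ X] [AddCommGroup Y] [Module Λ Y]
    (g : X →ₗ[Λ] Y) : (Y →ₗ[Λ] Λ) →ₗ[Λᵐᵒᵖ] (X →ₗ[Λ] Λ) where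
  toFun f := f ∘ₗ g
  map_add' _ _ := rfl
  map_smul' _ _ := rfl

@[simp] theorem dualMap_apply {X Y : Type*} [AddCommGroup X] [Module Λ X] [AddCommGroup Y]
    [Module Λ Y] (g : X →ₗ[Λ] Y) (f : Y →ₗ[Λ] Λ) : dualMap g f = f ∘ₗ g := rfl

theorem IsReflexive.of_isRetract {X Y : ModuleCat.{u} Λ} (h : IsRetract Λ X Y)
    (hY : IsReflexive Y) : IsReflexive X := by
  rw [isReflexive_iff] at hY ⊢
  obtain ⟨ι, π, h⟩ := h
  refine ⟨fun x hx => ?_, fun φ => ?_⟩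
  · rw [← h x, hY.1 (ι x) fun f => hx (f ∘ₗ ι), map_zero]
  · obtain ⟨y, hy⟩ := hY.2 (φ ∘ₗ dualMap ι)
    refine ⟨π y, fun f => ?_⟩
    have h1 : (f ∘ₗ π) ∘ₗ ι = f := LinearMap.ext fun x => congrArg f (h x)
    have := hy (f ∘ₗ π)
    rwa [LinearMap.comp_apply, dualMap_apply, h1] at this

theorem isReflexive_self : IsReflexive (ModuleCat.of Λ Λ) := by
  rw [isReflexive_iff]
  refine ⟨fun x hx => hx LinearMap.id, fun φ => ⟨φ LinearMap.id, fun f => ?_⟩⟩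
  have h : f = MulOpposite.op (f 1) • (LinearMap.id : Λ →ₗ[Λ] Λ) :=
    LinearMap.ext_ring (by simp)
  rw [h, map_smul]
  simp

theorem isReflexive_pi {ι : Type} [Fintype ι] (Y : ι → ModuleCat.{u} Λ)
    (h : ∀ i, IsReflexive (Y i)) : IsReflexive (ModuleCat.of Λ (∀ i, Y i)) := by
  classical
  simp only [isReflexive_iff] at h ⊢
  refine ⟨fun x hx => funext fun i => (h i).1 (x i) fun f => hx (f ∘ₗ LinearMap.proj i),
    fun φ => ?_⟩
  choose x hx using fun i => (h i).2 (φ ∘ₗ dualMap (LinearMap.proj i))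
  refine ⟨x, fun f => ?_⟩
  have h1 : f = ∑ i, (f ∘ₗ LinearMap.single Λ (fun i => Y i) i) ∘ₗ LinearMap.proj i := by
    refine LinearMap.ext fun y => ?_
    conv_lhs => rw [← Finset.univ_sum_single y, map_sum]
    rw [LinearMap.sum_apply]
    rfl
  have h2 : f x = ∑ i, f (Pi.single i (x i)) := by
    conv_lhs => rw [← Finset.univ_sum_single x, map_sum]
  rw [h2]
  conv_lhs => rw [h1, map_sum]
  exact Finset.sum_congr rfl fun i _ => hx i (f ∘ₗ LinearMap.single Λ (fun i => Y i) i)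

theorem isReflexive_prod {X Y : ModuleCat.{u} Λ} (hX : IsReflexive X) (hY : IsReflexive Y) :
    IsReflexive (ModuleCat.of Λ (X × Y)) := by
  simp only [isReflexive_iff] at hX hY ⊢
  refine ⟨fun p hp => Prod.ext (hX.1 _ fun f => hp (f ∘ₗ LinearMap.fst Λ X Y))
    (hY.1 _ fun f => hp (f ∘ₗ LinearMap.snd Λ X Y)), fun φ => ?_⟩
  obtain ⟨x, hx⟩ := hX.2 (φ ∘ₗ dualMap (LinearMap.fst Λ X Y))
  obtain ⟨y, hy⟩ := hY.2 (φ ∘ₗ dualMap (LinearMap.snd Λ X Y))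
  refine ⟨(x, y), fun f => ?_⟩
  have h1 : f = (f ∘ₗ LinearMap.inl Λ X Y) ∘ₗ LinearMap.fst Λ X Y +
      (f ∘ₗ LinearMap.inr Λ X Y) ∘ₗ LinearMap.snd Λ X Y := by
    refine LinearMap.ext fun p => ?_
    simp [← map_add]
  have h2 : f (x, y) = f (x, 0) + f (0, y) := by simp [← map_add]
  rw [h2]
  conv_lhs => rw [h1, map_add]
  exact congrArg₂ _ (hx (f ∘ₗ LinearMap.inl Λ X Y)) (hy (f ∘ₗ LinearMap.inr Λ X Y))

theorem linearMap_apply_eq_sum {n : ℕ} (h : (Fin n → Λ) →ₗ[Λ] Λ) (x : Fin n → Λ) :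
    h x = ∑ i, x i * h (Pi.single i 1) := by
  conv_lhs => rw [← Finset.univ_sum_single x, map_sum]
  refine Finset.sum_congr rfl fun i _ => ?_
  rw [← smul_eq_mul, ← map_smul, ← Pi.single_smul, smul_eq_mul, mul_one]

/-- The linear form on `Λ^n` with given coefficients. -/
def linearForm {n : ℕ} (c : Fin n → Λ) : (Fin n → Λ) →ₗ[Λ] Λ :=
  ∑ i, LinearMap.toSpanSingleton Λ Λ (c i) ∘ₗ LinearMap.proj i

@[simp] theorem linearForm_apply {n : ℕ} (c x : Fin n → Λ) :
    linearForm c x = ∑ i, x i * c i := by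
  simp [linearForm, LinearMap.sum_apply]

/-- A reflexive module embeds into a free module of finite rank such that all linear forms extend
and the image is the kernel of a map to a free module of finite rank. -/
theorem exists_approximation [IsNoetherian Λᵐᵒᵖ Λ] (X : ModuleCat.{u} Λ) (hfg : IsFG X)
    (hX : IsReflexive X) : ∃ (n m : ℕ) (F : X →ₗ[Λ] (Fin n → Λ))
      (G : (Fin n → Λ) →ₗ[Λ] (Fin m → Λ)), Function.Injective F ∧
      LinearMap.range F = LinearMap.ker G ∧
      ∀ g : X →ₗ[Λ] Λ, ∃ h : (Fin n → Λ) →ₗ[Λ] Λ, h ∘ₗ F = g := by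
  rw [isReflexive_iff] at hX
  have : IsNoetherian Λᵐᵒᵖ (X →ₗ[Λ] Λ) := by
    have : Module.Finite Λ X := hfg
    obtain ⟨k, s, hs⟩ := Module.Finite.exists_fin (R := Λ) (M := X)
    let ev : (X →ₗ[Λ] Λ) →ₗ[Λᵐᵒᵖ] (Fin k → Λ) :=
      { toFun := fun f i => f (s i)
        map_add' := fun _ _ => rfl
        map_smul' := fun _ _ => rfl }
    exact isNoetherian_of_injective ev fun f g h =>
      LinearMap.ext_on_range hs fun i => congrFun h i
  -- Present `X*` over `Λᵐᵒᵖ` by generators `p` and relations `r`. Dualizing gives `0 → X** → Λ^n →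
  -- Λ^m`, and `X ≅ X**`.
  obtain ⟨n, p, hp⟩ := Module.Finite.exists_fin (R := Λᵐᵒᵖ) (M := X →ₗ[Λ] Λ)
  let T : (Fin n → Λᵐᵒᵖ) →ₗ[Λᵐᵒᵖ] (X →ₗ[Λ] Λ) := Fintype.linearCombination Λᵐᵒᵖ p
  have hT : ∀ c, T c = ∑ i, c i • p i := fun c => Fintype.linearCombination_apply _ _ _
  have hTsurj : Function.Surjective T := by
    rw [← LinearMap.range_eq_top, Fintype.range_linearCombination, hp]
  have : IsNoetherian Λᵐᵒᵖ Λᵐᵒᵖ := by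
    let e : Λ ≃ₗ[Λᵐᵒᵖ] Λᵐᵒᵖ :=
      { MulOpposite.opAddEquiv with map_smul' := fun _ _ => rfl }
    exact isNoetherian_of_linearEquiv e
  obtain ⟨m, r, hr⟩ := Module.Finite.exists_fin (R := Λᵐᵒᵖ) (M := LinearMap.ker T)
  let F : X →ₗ[Λ] (Fin n → Λ) := LinearMap.pi p
  let G : (Fin n → Λ) →ₗ[Λ] (Fin m → Λ) :=
    LinearMap.pi fun j => linearForm fun i => ((r j).1 i).unop
  have hext : ∀ (c : Fin n → Λᵐᵒᵖ) (x : X), T c x = ∑ i, p i x * (c i).unop := fun c x => by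
    rw [hT, LinearMap.sum_apply]
    rfl
  have hrel : ∀ x : Fin n → Λ, G x = 0 → ∀ c, T c = 0 → ∑ i, x i * (c i).unop = 0 := by
    intro x hx c hc
    let L : LinearMap.ker T →ₗ[Λᵐᵒᵖ] Λ :=
      { toFun := fun c => ∑ i, x i * (c.1 i).unop
        map_add' := fun c d => by simp [mul_add, Finset.sum_add_distrib]
        map_smul' := fun a c => by
          simp [Finset.sum_mul, mul_assoc] }
    have : L = 0 := LinearMap.ext_on_range hr fun j => by
      have := congrFun hx j
      simpa [G, L] using this
    exact congr($this ⟨c, hc⟩)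
  refine ⟨n, m, F, G, ?_, ?_, ?_⟩
  · refine (injective_iff_map_eq_zero F).2 fun x hx => hX.1 x fun f => ?_
    obtain ⟨c, rfl⟩ := hTsurj f
    rw [hext]
    refine Finset.sum_eq_zero fun i _ => ?_
    have : p i x = 0 := congrFun hx i
    rw [this, zero_mul]
  · ext x
    constructor
    · rintro ⟨y, rfl⟩
      rw [LinearMap.mem_ker]
      ext j
      have : T (r j).1 = 0 := (r j).2
      have h2 := hext (r j).1 y
      rw [this] at h2
      simpa [G, F] using h2.symm
    · intro hx
      rw [LinearMap.mem_ker] at hx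
      let L : (Fin n → Λᵐᵒᵖ) →ₗ[Λᵐᵒᵖ] Λ :=
        { toFun := fun c => ∑ i, x i * (c i).unop
          map_add' := fun c d => by simp [mul_add, Finset.sum_add_distrib]
          map_smul' := fun a c => by
            simp [Finset.sum_mul, mul_assoc] }
      have hL : LinearMap.ker T ≤ LinearMap.ker L := fun c hc => hrel x hx c hc
      -- A vector killed by all relations defines a form on `X*`; by reflexivity it is evaluation at
      -- some `y`, and then `F y = x`.
      let φ : (X →ₗ[Λ] Λ) →ₗ[Λᵐᵒᵖ] Λ :=
        (LinearMap.ker T).liftQ L hL ∘ₗ (T.quotKerEquivOfSurjective hTsurj).symm.toLinearMap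
      have hφ : ∀ c, φ (T c) = L c := fun c => by
        have : (T.quotKerEquivOfSurjective hTsurj).symm (T c) = (LinearMap.ker T).mkQ c := by
          rw [LinearEquiv.symm_apply_eq]
          rfl
        simp only [φ, LinearMap.comp_apply, LinearEquiv.coe_coe, this]
        exact Submodule.liftQ_apply _ _ _
      obtain ⟨y, hy⟩ := hX.2 φ
      refine ⟨y, funext fun i => ?_⟩
      have h1 : T (Pi.single i 1) = p i := by
        rw [hT, Finset.sum_eq_single i] <;> simp +contextual
      have h2 := hφ (Pi.single i 1)
      rw [hy, h1] at h2
      change p i y = x i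
      rw [h2]
      change ∑ j, x j * ((Pi.single i 1 : Fin n → Λᵐᵒᵖ) j).unop = x i
      rw [Finset.sum_eq_single i] <;> simp +contextual
  · intro g
    obtain ⟨c, rfl⟩ := hTsurj g
    refine ⟨linearForm fun i => (c i).unop, LinearMap.ext fun x => ?_⟩
    rw [hext]
    simp [F]

/-- The kernel of a map from a reflexive module to a reflexive module is the kernel of a map
between free modules of finite rank. -/
theorem isFreeKernel_ker_of_isReflexive [IsNoetherian Λᵐᵒᵖ Λ] {X Y : ModuleCat.{u} Λ}
    (hXfg : IsFG X) (hX : IsReflexive X) (hYfg : IsFG Y) (hY : IsReflexive Y) (f : X →ₗ[Λ] Y) :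
    IsFreeKernel Λ Λ (LinearMap.ker f) := by
  obtain ⟨n, m, F, G, hF, hFG, hext⟩ := exists_approximation X hXfg hX
  obtain ⟨p, -, F', -, hF', -, -⟩ := exists_approximation Y hYfg hY
  -- The map `F' ∘ f` extends along `F` to `Λ^n`, so `F` identifies `ker f` with the common kernel
  -- of `G` and the extension.
  choose h hh using fun j => hext (LinearMap.proj j ∘ₗ F' ∘ₗ f)
  have hh' : ∀ x, LinearMap.pi h (F x) = F' (f x) := fun x => funext fun j => congr($(hh j) x)
  let e : ((Fin m → Λ) × (Fin p → Λ)) ≃ₗ[Λ] (Fin (m + p) → Λ) :=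
    (LinearEquiv.sumArrowLequivProdArrow (Fin m) (Fin p) Λ Λ).symm.trans
      (LinearEquiv.funCongrLeft Λ Λ finSumFinEquiv.symm)
  refine IsFreeKernel.of_equiv ?_ (isFreeKernel_ker (.of_equiv (.refl _ _))
    (.of_equiv e) (LinearMap.prod G (LinearMap.pi h)))
  have hmem : ∀ y, y ∈ LinearMap.ker (LinearMap.prod G (LinearMap.pi h)) ↔
      y ∈ (LinearMap.ker f).map F := by
    intro y
    rw [LinearMap.ker_prod, Submodule.mem_inf, ← hFG, Submodule.mem_map]
    constructor
    · rintro ⟨⟨x, rfl⟩, hx⟩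
      refine ⟨x, ?_, rfl⟩
      rw [LinearMap.mem_ker, hh'] at hx
      rw [LinearMap.mem_ker]
      exact hF' (by rw [hx, map_zero])
    · rintro ⟨x, hx, rfl⟩
      refine ⟨⟨x, rfl⟩, ?_⟩
      rw [LinearMap.mem_ker] at hx ⊢
      rw [hh', hx, map_zero]
  exact (Submodule.equivMapOfInjective F hF _).trans
    (LinearEquiv.ofEq _ _ (Submodule.ext fun y => (hmem y).symm))

theorem IsReflexive.isFreeKernel [IsNoetherian Λᵐᵒᵖ Λ] {X : ModuleCat.{u} Λ}
    (hfg : IsFG X) (hX : IsReflexive X) : IsFreeKernel Λ Λ X :=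
  (isFreeKernel_ker_of_isReflexive hfg hX hfg hX 0).of_equiv
    ((LinearEquiv.ofTop _ LinearMap.ker_zero).symm)

variable (Λ) in
/-- Linear forms on submodules of `Λ^n` extend to `Λ^n` after multiplication by suitable elements
of `Λ`, which can be chosen not to annihilate a given nonzero element. -/
def ExtendsUpToMul : Prop :=
  ∀ (n : ℕ) (K : Submodule Λ (Fin n → Λ)) (g : K →ₗ[Λ] Λ) (x : Λ), x ≠ 0 →
    ∃ a : Λ, x * a ≠ 0 ∧ ∃ h : (Fin n → Λ) →ₗ[Λ] Λ, ∀ k : K, h k = g k * a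

/-- For `φ` in the bidual of `ker G`, the values on the coordinate forms make up a vector of `ker
G`, and `φ` agrees with evaluation there on every form extending to `Λ^n`. For a general form `g`, a
nonzero discrepancy would survive multiplication by some `a` for which `g a` extends. -/
theorem IsFreeKernel.isReflexive (H : ExtendsUpToMul Λ) {X : ModuleCat.{u} Λ}
    (hX : IsFreeKernel Λ Λ X) : IsReflexive X := by
  obtain ⟨n, m, G, ⟨e⟩⟩ := hX
  refine IsReflexive.of_isRetract (Y := ModuleCat.of Λ (LinearMap.ker G)) (.of_equiv e) ?_
  rw [isReflexive_iff]
  refine ⟨fun x hx => Subtype.ext (funext fun i =>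
    hx (LinearMap.proj i ∘ₗ Submodule.subtype _)), fun φ => ?_⟩
  change (LinearMap.ker G →ₗ[Λ] Λ) →ₗ[Λᵐᵒᵖ] Λ at φ
  let p : Fin n → (LinearMap.ker G →ₗ[Λ] Λ) := fun i => LinearMap.proj i ∘ₗ Submodule.subtype _
  have hres : ∀ h : (Fin n → Λ) →ₗ[Λ] Λ, φ (h ∘ₗ Submodule.subtype _) = h fun i => φ (p i) := by
    intro h
    have : h ∘ₗ Submodule.subtype (LinearMap.ker G) =
        ∑ i, MulOpposite.op (h (Pi.single i 1)) • p i := by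
      refine LinearMap.ext fun x => ?_
      rw [LinearMap.comp_apply, linearMap_apply_eq_sum, LinearMap.sum_apply]
      rfl
    rw [this, map_sum, linearMap_apply_eq_sum h]
    refine Finset.sum_congr rfl fun i _ => ?_
    rw [map_smul]
    rfl
  have hx : (fun i => φ (p i)) ∈ LinearMap.ker G := by
    rw [LinearMap.mem_ker]
    ext j
    have h0 : (LinearMap.proj j ∘ₗ G) ∘ₗ Submodule.subtype (LinearMap.ker G) = 0 :=
      LinearMap.ext fun x => congrFun (LinearMap.mem_ker.1 x.2) j
    have := hres (LinearMap.proj j ∘ₗ G)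
    rw [h0, map_zero] at this
    exact this.symm
  refine ⟨⟨_, hx⟩, fun (g : LinearMap.ker G →ₗ[Λ] Λ) => ?_⟩
  by_contra hne
  obtain ⟨a, ha, h, hh⟩ := H n (LinearMap.ker G) g _ (sub_ne_zero.2 hne)
  apply ha
  have h1 : h ∘ₗ Submodule.subtype (LinearMap.ker G) = MulOpposite.op a • g :=
    LinearMap.ext hh
  have h2 := hres h
  rw [h1, map_smul] at h2
  have h3 := hh ⟨_, hx⟩
  rw [sub_mul, sub_eq_zero]
  exact h2.trans h3

/-- The form extends with values in the injective `I`. As `I` is projective, it embeds in a free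
module, and some coordinate `q` does not kill `j x`; on `Λ` the map `q ∘ j` is right multiplication
by `q (j 1)`. -/
theorem IsOneGorenstein.extendsUpToMul (h : IsOneGorenstein Λ) : ExtendsUpToMul Λ := by
  obtain ⟨I, j, hj, -, hI, hP⟩ := h
  intro n K g x hx
  obtain ⟨h, hh⟩ := hI.out K.subtype (Submodule.injective_subtype _) (j ∘ₗ g)
  obtain ⟨s, hs⟩ := hP.out
  have h1 : s (j x) ≠ 0 := fun h0 => hx (hj (hs.injective (by rw [h0, map_zero, map_zero])))
  obtain ⟨i, hi⟩ := Finsupp.ne_iff.1 h1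
  let q : I →ₗ[Λ] Λ := Finsupp.lapply i ∘ₗ s
  have hq : ∀ y : Λ, q (j y) = y * q (j 1) := fun y => by
    rw [← smul_eq_mul, ← map_smul, ← map_smul, smul_eq_mul, mul_one]
  refine ⟨q (j 1), ?_, q ∘ₗ h, fun k => ?_⟩
  · rw [← hq]
    exact hi
  · rw [← hq]
    exact congrArg q (hh k)

end Reflexive

/-! ### Extension of linear forms over orders in semisimple algebras -/

section Orders

theorem exists_smul_eq_one_tmul {R K Λ : Type*} [CommRing R] [IsDomain R] [Field K] [Algebra R K]
    [IsFractionRing R K] [Ring Λ] [Algebra R Λ] (a : K ⊗[R] Λ) :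
    ∃ s : R, s ≠ 0 ∧ ∃ x : Λ, s • a = 1 ⊗ₜ x := by
  induction a with
  | zero => exact ⟨1, one_ne_zero, 0, by simp⟩
  | tmul q x =>
    obtain ⟨p, s, hs, rfl⟩ := IsFractionRing.div_surjective (A := R) q
    have hs0 : s ≠ 0 := nonZeroDivisors.ne_zero hs
    refine ⟨s, hs0, p • x, ?_⟩
    rw [← TensorProduct.smul_tmul, TensorProduct.smul_tmul']
    congr 1
    rw [Algebra.smul_def, Algebra.smul_def, mul_one, mul_div_cancel₀]
    simpa using hs0
  | add a b ha hb =>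
    obtain ⟨s, hs, x, hx⟩ := ha
    obtain ⟨t, ht, y, hy⟩ := hb
    refine ⟨s * t, mul_ne_zero hs ht, t • x + s • y, ?_⟩
    rw [smul_add, TensorProduct.tmul_add, ← TensorProduct.smul_tmul, ← TensorProduct.smul_tmul,
      ← TensorProduct.smul_tmul', ← TensorProduct.smul_tmul', ← hx, ← hy, smul_smul, smul_smul,
      mul_comm t s]

/-- Over the semisimple algebra `A = K ⊗ Λ`, the span of the submodule splits off from `A^n`.
Clearing denominators in the projection gives a map from `Λ^n` to the submodule that restricts to
multiplication by a nonzero, hence central and regular, element of `R`. -/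
theorem extendsUpToMul_of_isSemisimpleRing {R K Λ : Type u} [CommRing R] [IsDomain R]
    [Field K] [Algebra R K] [IsFractionRing R K] [Ring Λ] [Algebra R Λ] [Module.Flat R Λ]
    [IsSemisimpleRing (K ⊗[R] Λ)] : ExtendsUpToMul Λ := by
  intro n L g x hx
  let A := K ⊗[R] Λ
  let j : Λ →ₐ[R] A := Algebra.TensorProduct.includeRight
  have hj : Function.Injective j :=
    Algebra.TensorProduct.includeRight_injective (IsFractionRing.injective R K)
  let J : (Fin n → Λ) → (Fin n → A) := fun y i => j (y i)
  have hJ : Function.Injective J := fun y z h => funext fun i => hj (congrFun h i)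
  have hJadd : ∀ y z, J (y + z) = J y + J z := fun y z => funext fun i => map_add j _ _
  have hJmul : ∀ (r : Λ) y, J (r • y) = j r • J y := fun r y => funext fun i => map_mul j _ _
  have hJsmul : ∀ (r : R) y, J (r • y) = r • J y := fun r y => funext fun i => map_smul j _ _
  have hJsum : ∀ f : Fin n → (Fin n → Λ), J (∑ i, f i) = ∑ i, J (f i) := fun f =>
    map_sum (AddMonoidHom.mk' J hJadd) f _
  let W : Submodule A (Fin n → A) := Submodule.span A (J '' L)
  have hW : ∀ w ∈ W, ∃ r : R, r ≠ 0 ∧ ∃ k ∈ L, r • w = J k := by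
    intro w hw
    induction hw using Submodule.span_induction with
    | mem w hw =>
      obtain ⟨k, hk, rfl⟩ := hw
      exact ⟨1, one_ne_zero, k, hk, one_smul _ _⟩
    | zero => exact ⟨1, one_ne_zero, 0, L.zero_mem, by
        rw [smul_zero]; exact funext fun i => (map_zero j).symm⟩
    | add v w _ _ hv hw =>
      obtain ⟨s, hs, k, hk, hsk⟩ := hv
      obtain ⟨t, ht, l, hl, htl⟩ := hw
      refine ⟨s * t, mul_ne_zero hs ht, t • k + s • l, L.add_mem ?_ ?_, ?_⟩
      · exact (L.restrictScalars R).smul_mem t hk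
      · exact (L.restrictScalars R).smul_mem s hl
      · rw [hJadd, hJsmul, hJsmul, ← hsk, ← htl, smul_add, smul_smul, smul_smul, mul_comm t s]
    | smul a w _ hw =>
      obtain ⟨s, hs, k, hk, hsk⟩ := hw
      obtain ⟨t, ht, y, hty⟩ := exists_smul_eq_one_tmul (R := R) a
      refine ⟨t * s, mul_ne_zero ht hs, y • k, L.smul_mem y hk, ?_⟩
      rw [hJmul, ← hsk, show j y = t • a from hty.symm, smul_smul_smul_comm, smul_eq_mul]
  obtain ⟨W', hW'⟩ := exists_isCompl W
  let π := W.projectionOnto W' hW'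
  -- `r i` is a denominator for the projection of the `i`-th basis vector; their product serves all
  -- of them.
  choose r hr k hk hrk using fun i : Fin n => hW (π (J (Pi.single i 1))) (π _).2
  have hr0 : ∏ i, r i ≠ 0 := Finset.prod_ne_zero_iff.2 fun i _ => hr i
  let c : Fin n → L := fun i =>
    ⟨(∏ i' ∈ Finset.univ.erase i, r i') • k i, (L.restrictScalars R).smul_mem _ (hk i)⟩
  have hc : ∀ i, J (c i) = (∏ i, r i) • (π (J (Pi.single i 1)) : Fin n → A) := by
    intro i
    rw [hJsmul, ← hrk, smul_smul, Finset.prod_erase_mul _ _ (Finset.mem_univ i)]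
  let ρ : (Fin n → Λ) →ₗ[Λ] L :=
    ∑ i, LinearMap.toSpanSingleton Λ L (c i) ∘ₗ LinearMap.proj i
  have hρ : ∀ y, J (ρ y) = (∏ i, r i) • (π (J y) : Fin n → A) := by
    intro y
    have h1 : (ρ y : Fin n → Λ) = ∑ i, y i • (c i : Fin n → Λ) := by
      simp [ρ, LinearMap.sum_apply]
    have h2 : J y = ∑ i, j (y i) • J (Pi.single i 1) := by
      conv_lhs => rw [← Finset.univ_sum_single y, hJsum]
      refine Finset.sum_congr rfl fun i _ => ?_
      rw [← hJmul, ← Pi.single_smul, smul_eq_mul, mul_one]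
    rw [h1, hJsum, h2, map_sum, AddSubmonoidClass.coe_finsetSum, Finset.smul_sum]
    refine Finset.sum_congr rfl fun i _ => ?_
    rw [hJmul, hc, map_smul, Submodule.coe_smul, smul_comm]
  refine ⟨algebraMap R Λ (∏ i, r i), ?_, g ∘ₗ ρ, fun y => ?_⟩
  · rw [← Algebra.commutes, ← Algebra.smul_def]
    intro h0
    have h1 : (algebraMap R K (∏ i, r i)) • j x = 0 := by
      rw [algebraMap_smul, ← map_smul, h0, map_zero]
    rcases smul_eq_zero.1 h1 with h2 | h2
    · exact hr0 ((map_eq_zero_iff _ (IsFractionRing.injective R K)).1 h2)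
    · exact hx (hj (by rw [h2, map_zero]))
  · have h1 : π (J y) = ⟨J y, Submodule.subset_span ⟨y, y.2, rfl⟩⟩ :=
      Submodule.projectionOnto_apply_left hW' ⟨J y, Submodule.subset_span ⟨y, y.2, rfl⟩⟩
    have h2 : ρ y = algebraMap R Λ (∏ i, r i) • y := by
      refine Subtype.ext (hJ ?_)
      rw [hρ, h1, ← hJsmul, Submodule.coe_smul, algebraMap_smul]
    rw [LinearMap.comp_apply, h2, map_smul, smul_eq_mul, Algebra.commutes]

end Orders

/-! ### Second syzygies and kernels between free modules -/

section Syzygies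

variable {Λ : Type u} [Ring Λ]

theorem isRetract_of_finite_projective {P : Type*} [AddCommGroup P] [Module Λ P]
    [Module.Finite Λ P] [Module.Projective Λ P] : ∃ n : ℕ, IsRetract Λ P (Fin n → Λ) := by
  obtain ⟨n, f, hf⟩ := Module.Finite.exists_fin' Λ P
  obtain ⟨s, hs⟩ := Module.projective_lifting_property f LinearMap.id hf
  exact ⟨n, s, f, fun x => congr($hs x)⟩

/-- The kernel of `f` is a second syzygy of the cokernel of `f`. -/
theorem isSyzygy_two_of_isFreeKernel {X : ModuleCat.{u} Λ} (h : IsFreeKernel Λ Λ X) :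
    ∃ C : ModuleCat.{u} Λ, IsFG C ∧ IsSyzygy 2 X C := by
  obtain ⟨n, m, f, ⟨e⟩⟩ := h
  refine ⟨ModuleCat.of Λ ((Fin m → Λ) ⧸ LinearMap.range f),
    inferInstanceAs (Module.Finite Λ ((Fin m → Λ) ⧸ LinearMap.range f)),
    ModuleCat.of Λ (Fin m → Λ), (LinearMap.range f).mkQ,
    inferInstanceAs (Module.Finite Λ (Fin m → Λ)),
    inferInstanceAs (Module.Projective Λ (Fin m → Λ)), Submodule.mkQ_surjective _,
    ModuleCat.of Λ (Fin n → Λ), LinearMap.codRestrict _ f fun x => by simp,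
    inferInstanceAs (Module.Finite Λ (Fin n → Λ)),
    inferInstanceAs (Module.Projective Λ (Fin n → Λ)), ?_, ⟨e.trans (LinearEquiv.ofEq _ _ ?_)⟩⟩
  · rintro ⟨y, hy⟩
    rw [Submodule.ker_mkQ] at hy
    obtain ⟨x, rfl⟩ := hy
    exact ⟨x, rfl⟩
  · rw [LinearMap.ker_codRestrict]

theorem IsSyzygy.isFreeKernel {K X : ModuleCat.{u} Λ} (h : IsSyzygy 2 K X) :
    IsFreeKernel Λ Λ K := by
  obtain ⟨P, f, _, _, -, P', f', _, _, -, ⟨e⟩⟩ := h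
  obtain ⟨a, ha⟩ := isRetract_of_finite_projective (Λ := Λ) (P := P')
  obtain ⟨b, hb⟩ := isRetract_of_finite_projective (Λ := Λ) (P := P)
  refine (isFreeKernel_ker ha hb (Submodule.subtype _ ∘ₗ f')).of_equiv (e.trans
    (LinearEquiv.ofEq _ _ ?_))
  rw [LinearMap.ker_comp_of_ker_eq_bot _ (Submodule.ker_subtype _)]

theorem addSyzygy_of_isFreeKernel {X : ModuleCat.{u} Λ} (h : IsFreeKernel Λ Λ X) :
    AddSyzygy Λ 2 X :=
  ⟨1, fun _ => X, fun _ => isSyzygy_two_of_isFreeKernel h,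
    LinearMap.pi fun _ => LinearMap.id, LinearMap.proj 0, rfl⟩

theorem AddSyzygy.exists_isRetract {X : ModuleCat.{u} Λ} (h : AddSyzygy Λ 2 X) :
    ∃ (n : ℕ) (Y : Fin n → ModuleCat.{u} Λ), (∀ i, IsFreeKernel Λ Λ (Y i)) ∧
      IsRetract Λ X (∀ i, Y i) := by
  obtain ⟨n, Y, hY, ι, π, h⟩ := h
  refine ⟨n, Y, fun i => ?_, ι, π, fun x => congr($h x)⟩
  obtain ⟨C, -, hC⟩ := hY i
  exact hC.isFreeKernel

theorem IsFreeKernel.isFG [IsNoetherianRing Λ] {X : ModuleCat.{u} Λ} (h : IsFreeKernel Λ Λ X) :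
    IsFG X := by
  obtain ⟨n, m, f, ⟨e⟩⟩ := h
  exact Module.Finite.equiv e.symm

theorem AddSyzygy.isFG [IsNoetherianRing Λ] {X : ModuleCat.{u} Λ} (h : AddSyzygy Λ 2 X) :
    IsFG X := by
  obtain ⟨n, Y, hY, h⟩ := h.exists_isRetract
  have : ∀ i, Module.Finite Λ (Y i) := fun i => (hY i).isFG
  exact h.finite

end Syzygies

/-! ### Finiteness over a noetherian base -/

section FiniteAlgebras

variable {R : Type u} [CommRing R] [IsNoetherianRing R] {Λ : Type u} [Ring Λ] [Algebra R Λ]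

/-- A module over an `R`-algebra, viewed as an `R`-module. -/
abbrev moduleOfAlgebra (R : Type*) [CommRing R] (Λ : Type*) [Ring Λ] [Algebra R Λ] (X : Type*)
    [AddCommGroup X] [Module Λ X] : Module R X := Module.compHom X (algebraMap R Λ)

theorem isScalarTower_moduleOfAlgebra (R : Type*) [CommRing R] (Λ : Type*) [Ring Λ] [Algebra R Λ]
    (X : Type*) [AddCommGroup X] [Module Λ X] :
    letI := moduleOfAlgebra R Λ X
    IsScalarTower R Λ X :=
  let := moduleOfAlgebra R Λ X
  ⟨fun r a x => by rw [Algebra.smul_def, mul_smul]; rfl⟩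

theorem isLocalRing_end_of_finite [Module.Finite R Λ] (J : Ideal R) [IsAdicComplete J R] [IsArtinianRing (R ⧸ J)]
    {X : ModuleCat.{u} Λ} [Module.Finite Λ X] (hX : Indecomposable X) :
    IsLocalRing (Module.End Λ X) := by
  let := moduleOfAlgebra R Λ X
  have := isScalarTower_moduleOfAlgebra R Λ X
  have : Module.Finite R X := Module.Finite.trans Λ X
  exact isLocalRing_end_of_indecomposable J X hX

theorem isNoetherianRing_of_finite_algebra (R : Type*) [CommRing R] [IsNoetherianRing R] (A : Type*) [Ring A] [Algebra R A] [Module.Finite R A] :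
    IsNoetherianRing A :=
  isNoetherian_of_tower R inferInstance

theorem isNoetherian_op_of_finite_algebra (R Λ : Type*) [CommRing R] [IsNoetherianRing R]
    [Ring Λ] [Algebra R Λ] [Module.Finite R Λ] : IsNoetherian Λᵐᵒᵖ Λ :=
  isNoetherian_of_tower R (inferInstance : IsNoetherian R Λ)

theorem finite_endRing (M : Type u) [AddCommGroup M] [Module Λ M] [Module R M]
    [IsScalarTower R Λ M] [Module.Finite R M] : Module.Finite R (EndRing Λ M) := by
  have : Module.Finite R (Module.End Λ M) := finite_linearMap
  exact Module.Finite.equiv (MulOpposite.opLinearEquiv R)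

theorem isNoetherianRing_endRing (R : Type u) [CommRing R] [IsNoetherianRing R] {Λ : Type u}
    [Ring Λ] [Algebra R Λ] [Module.Finite R Λ] (M : Type u) [AddCommGroup M] [Module Λ M]
    [Module.Finite Λ M] :
    IsNoetherianRing (EndRing Λ M) := by
  let := moduleOfAlgebra R Λ M
  have := isScalarTower_moduleOfAlgebra R Λ M
  have : Module.Finite R M := Module.Finite.trans Λ M
  have : Module.Finite R (EndRing Λ M) := finite_endRing M
  exact isNoetherianRing_of_finite_algebra R _

end FiniteAlgebras

/-! ### Additive generators and finiteness -/

section Generators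

variable {Λ : Type u} [Ring Λ]

theorem isRetract_fst (N : Type*) [AddCommGroup N] [Module Λ N] : IsRetract Λ Λ (Λ × N) :=
  ⟨LinearMap.inl Λ Λ N, LinearMap.fst Λ Λ N, fun _ => rfl⟩

theorem isRetract_pi_single {X Y : Type*} [AddCommGroup X] [Module Λ X] [AddCommGroup Y]
    [Module Λ Y] (h : IsRetract Λ X Y) : IsRetract Λ X (Fin 1 → Y) :=
  h.trans ⟨LinearMap.pi fun _ => LinearMap.id, LinearMap.proj 0, fun _ => rfl⟩

theorem isRetract_pi_apply {k : ℕ} (Y : Fin k → ModuleCat.{u} Λ) (i : Fin k) :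
    IsRetract Λ (Y i) (∀ i, Y i) :=
  ⟨LinearMap.single Λ (fun i => Y i) i, LinearMap.proj i, fun x => by simp⟩

theorem IsRetract.pow {X Y : Type*} [AddCommGroup X] [Module Λ X] [AddCommGroup Y]
    [Module Λ Y] (h : IsRetract Λ X Y) (k : ℕ) : IsRetract Λ (Fin k → X) (Fin k → Y) := by
  obtain ⟨ι, π, h⟩ := h
  exact ⟨LinearMap.pi fun i => ι ∘ₗ LinearMap.proj i, LinearMap.pi fun i => π ∘ₗ LinearMap.proj i,
    fun x => funext fun i => h (x i)⟩

/-- Since `Λ` is a summand of `M`, a kernel between free modules is also one between powers of `M`,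
where every map is a matrix over `End_Λ(M)`. -/
theorem IsFreeKernel.exists_isRetract {M : Type u} [AddCommGroup M] [Module Λ M]
    (hM : IsRetract Λ Λ M) [IsNoetherianRing (EndRing Λ M)] (h : gldim (EndRing Λ M) ≤ 2)
    {X : Type u} [AddCommGroup X] [Module Λ X] (hX : IsFreeKernel Λ Λ X) :
    ∃ k : ℕ, IsRetract Λ X (Fin k → M) := by
  obtain ⟨a, b, f, ⟨e⟩⟩ := hX.of_isRetract (isRetract_pi_single hM)
  obtain ⟨U, rfl⟩ := exists_matHom_eq f
  obtain ⟨k, hk⟩ := exists_isRetract_ker_matHom hM h U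
  exact ⟨k, (IsRetract.of_equiv e).trans hk⟩

/-- An indecomposable `X` in `X_2` has local endomorphism ring, so it is a summand of a single
second syzygy, which lies in `add M`, and hence of `M` itself. -/
theorem finite_ind_addSyzygy (hloc : ∀ X : ModuleCat.{u} Λ, IsFG X → Indecomposable X →
    IsLocalRing (Module.End Λ X)) [IsNoetherianRing Λ] {M : Type u} [AddCommGroup M] [Module Λ M]
    [Module.Finite Λ M] (hM : IsRetract Λ Λ M) [IsNoetherianRing (EndRing Λ M)]
    (h : gldim (EndRing Λ M) ≤ 2) : (ind (AddSyzygy Λ 2)).Finite := by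
  refine (finite_indecomposable_retracts (ModuleCat.of Λ M)).subset ?_
  rintro _ ⟨X, hX, hi, rfl⟩
  have := hloc X hX.isFG hi
  obtain ⟨n, Y, hY, h1⟩ := hX.exists_isRetract
  obtain ⟨i, h2⟩ := h1.exists_of_pi
  obtain ⟨k, h3⟩ := (hY i).exists_isRetract hM h
  obtain ⟨-, h4⟩ := (h2.trans h3).exists_of_pi
  exact ⟨X, ⟨this, h4⟩, hi, rfl⟩

/-- A class of modules closed under direct summands, consisting of noetherian modules and having
finitely many indecomposables, is contained in the summands of powers of one finite product of
modules in the class. -/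
theorem exists_additive_generator (C : ModuleCat.{u} Λ → Prop)
    (hnoeth : ∀ X, C X → IsNoetherian Λ X)
    (hretr : ∀ X Y : ModuleCat.{u} Λ, IsRetract Λ X Y → C Y → C X) (hfin : (ind C).Finite) :
    ∃ (n : ℕ) (Y : Fin n → ModuleCat.{u} Λ), (∀ i, C (Y i)) ∧
      ∀ X, C X → ∃ k : ℕ, IsRetract Λ X (Fin k → ∀ i, Y i) := by
  obtain ⟨n, f, hf⟩ := hfin.fin_embedding
  have hf' : ∀ i, ∃ X : ModuleCat.{u} Λ, C X ∧ Indecomposable X ∧ Quotient.mk _ X = f i :=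
    fun i => by
      have : f i ∈ ind C := hf ▸ Set.mem_range_self i
      exact this
  choose Y hYC hYi hYf using hf'
  refine ⟨n, Y, hYC, fun X hX => ?_⟩
  have := hnoeth X hX
  refine noetherian_module_induction
    (fun X => C X → ∃ k : ℕ, IsRetract Λ X (Fin k → ∀ i, Y i)) ?_ ?_ ?_ ?_ X hX
  · rintro X X' e h hX'
    obtain ⟨k, hk⟩ := h (hretr _ _ (.of_equiv e) hX')
    exact ⟨k, (IsRetract.of_equiv e.symm).trans hk⟩
  · rintro X hX -
    exact ⟨0, 0, 0, fun x => Subsingleton.elim _ _⟩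
  · rintro X hi hX
    have : Quotient.mk _ X ∈ ind C := ⟨X, hX, hi, rfl⟩
    rw [← hf] at this
    obtain ⟨i, h⟩ := this
    rw [← hYf] at h
    obtain ⟨e⟩ := Quotient.exact h
    exact ⟨1, (IsRetract.of_equiv e.toLinearEquiv.symm).trans
      (isRetract_pi_single (isRetract_pi_apply Y i))⟩
  · rintro A B hA hB hAB
    obtain ⟨k, ι, π, h⟩ := hA (hretr _ (ModuleCat.of Λ (A × B))
      ⟨LinearMap.inl Λ A B, LinearMap.fst Λ A B, fun _ => rfl⟩ hAB)
    obtain ⟨l, ι', π', h'⟩ := hB (hretr _ (ModuleCat.of Λ (A × B))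
      ⟨LinearMap.inr Λ A B, LinearMap.snd Λ A B, fun _ => rfl⟩ hAB)
    refine ⟨k + l, IsRetract.trans (Y := (Fin k → ∀ i, Y i) × (Fin l → ∀ i, Y i))
      ⟨ι.prodMap ι', π.prodMap π', fun x => Prod.ext (h x.1) (h' x.2)⟩ (.of_equiv
      ((LinearEquiv.sumArrowLequivProdArrow (Fin k) (Fin l) Λ _).symm.trans
        (LinearEquiv.funCongrLeft Λ _ finSumFinEquiv.symm)))⟩

/-- If all kernels between free modules are reflexive and there are only finitely many
indecomposable reflexive modules, then there is a reflexive `N` with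
`gl.dim End(Λ ⊕ N) ≤ 2`. -/
theorem exists_gldim_endRing_le_two [IsNoetherianRing Λ] [IsNoetherian Λᵐᵒᵖ Λ]
    (hend : ∀ M : ModuleCat.{u} Λ, IsFG M → IsNoetherianRing (EndRing Λ M))
    (href : ∀ X : ModuleCat.{u} Λ, IsFreeKernel Λ Λ X → IsReflexive X)
    (hfin : ReflexiveFinite Λ) : ∃ N : ModuleCat.{u} Λ, IsFG N ∧ IsReflexive N ∧
      gldim (EndRing Λ (Λ × N)) ≤ 2 := by
  obtain ⟨n, Y, hY, hgen⟩ := exists_additive_generator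
    (fun X : ModuleCat.{u} Λ => IsFG X ∧ IsReflexive X)
    (fun X hX => by have : Module.Finite Λ X := hX.1; infer_instance)
    (fun X Y h hY => ⟨by have : Module.Finite Λ Y := hY.1; exact h.finite, hY.2.of_isRetract h⟩)
    hfin
  have hfg : ∀ i, Module.Finite Λ (Y i) := fun i => (hY i).1
  let N : ModuleCat.{u} Λ := ModuleCat.of Λ (∀ i, Y i)
  have hNfg : Module.Finite Λ N := inferInstanceAs (Module.Finite Λ (∀ i, Y i))
  have hN : IsReflexive N := isReflexive_pi Y fun i => (hY i).2
  refine ⟨N, hNfg, hN, ?_⟩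
  have := hend (ModuleCat.of Λ (Λ × N)) (inferInstanceAs (Module.Finite Λ (Λ × N)))
  have : IsNoetherianRing (EndRing Λ (Λ × N)) := this
  refine gldim_le_two_of_projective_ker fun a b U => ?_
  have hM : IsReflexive (ModuleCat.of Λ (Λ × N)) := isReflexive_prod isReflexive_self hN
  have hpow : ∀ c : ℕ, IsReflexive (ModuleCat.of Λ (Fin c → Λ × N)) := fun c =>
    isReflexive_pi (fun _ => ModuleCat.of Λ (Λ × N)) fun _ => hM
  -- The kernel is one between free modules, hence reflexive by `href`, hence in the additive
  -- closure of `N`.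
  have hK := isFreeKernel_ker_of_isReflexive (X := ModuleCat.of Λ (Fin a → Λ × N))
    (Y := ModuleCat.of Λ (Fin b → Λ × N)) (inferInstanceAs (Module.Finite Λ (Fin a → Λ × N)))
    (hpow a) (inferInstanceAs (Module.Finite Λ (Fin b → Λ × N))) (hpow b) (matHom U)
  obtain ⟨k, hk⟩ := hgen (ModuleCat.of Λ (LinearMap.ker (matHom U)))
    ⟨IsFreeKernel.isFG hK, href _ hK⟩
  refine projective_ker_of_isRetract_ker_matHom U (k := k) (hk.trans (IsRetract.pow ?_ k))
  exact ⟨LinearMap.inr Λ Λ N, LinearMap.snd Λ Λ N, fun _ => rfl⟩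

end Generators

/-! ### Artin algebras -/

section ArtinAlgebras

/-- The order is well-founded, so a nonempty infimum is attained; the empty one is `⊤`. -/
theorem exists_le_two_of_sInf_le_two {S : Set (WithBot ℕ∞)} (h : sInf S ≤ 2) :
    ∃ d ∈ S, d ≤ 2 := by
  rcases S.eq_empty_or_nonempty with rfl | hS
  · rw [sInf_empty] at h
    exact absurd h (by decide)
  · exact ⟨_, csInf_mem hS, h⟩

theorem exists_of_rFun_le_two {Λ : Type u} [Ring Λ] {C : ModuleCat.{u} Λ → Prop}
    {M : ModuleCat.{u} Λ} (h : rFun C M ≤ 2) :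
    ∃ N : ModuleCat.{u} Λ, C N ∧ gldim (EndRing Λ (M × N)) ≤ 2 := by
  obtain ⟨_, ⟨N, rfl⟩, h⟩ := exists_le_two_of_sInf_le_two h
  exact ⟨N.1, N.2, h⟩

theorem rFun_le_two {Λ : Type u} [Ring Λ] {C : ModuleCat.{u} Λ → Prop}
    {M N : ModuleCat.{u} Λ} (hN : C N) (h : gldim (EndRing Λ (M × N)) ≤ 2) : rFun C M ≤ 2 :=
  iInf_le_of_le ⟨N, hN⟩ h

theorem finite_ind_addSyzygy_of_rFun_le_two (R : Type u) [CommRing R] [IsArtinianRing R]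
    {Λ : Type u} [Ring Λ] [Algebra R Λ] [Module.Finite R Λ]
    (h : rFun IsFG (ModuleCat.of Λ Λ) ≤ 2) :
    (ind (AddSyzygy Λ 2)).Finite := by
  have := isNoetherianRing_of_finite_algebra R Λ
  obtain ⟨N, hN, h⟩ := exists_of_rFun_le_two h
  have : Module.Finite Λ N := hN
  -- An artinian base is complete for the zero ideal, so the locality result applies with `J = ⊥`.
  have : IsArtinianRing (R ⧸ (⊥ : Ideal R)) := inferInstance
  have := isNoetherianRing_endRing R (Λ := Λ) (Λ × N)
  refine finite_ind_addSyzygy (fun X hX hi => ?_) (isRetract_fst N) h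
  have : Module.Finite Λ X := hX
  exact isLocalRing_end_of_finite (⊥ : Ideal R) hi

theorem rFun_le_two_of_reflexiveFinite (R : Type u) [CommRing R] [IsArtinianRing R]
    {Λ : Type u} [Ring Λ] [Algebra R Λ] [Module.Finite R Λ]
    (href : ∀ X : ModuleCat.{u} Λ, AddSyzygy Λ 2 X → IsReflexive X) (h : ReflexiveFinite Λ) :
    rFun IsFG (ModuleCat.of Λ Λ) ≤ 2 := by
  have := isNoetherianRing_of_finite_algebra R Λ
  have := isNoetherian_op_of_finite_algebra R Λ
  obtain ⟨N, hN, -, h⟩ := exists_gldim_endRing_le_two (fun M hM => by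
    have : Module.Finite Λ M := hM
    exact isNoetherianRing_endRing R (Λ := Λ) M)
    (fun X hX => href X (addSyzygy_of_isFreeKernel hX)) h
  exact rFun_le_two hN h

theorem addSyzygy_iff (R : Type u) [CommRing R] [IsArtinianRing R]
    {Λ : Type u} [Ring Λ] [Algebra R Λ] [Module.Finite R Λ]
    (href : ∀ X : ModuleCat.{u} Λ, AddSyzygy Λ 2 X → IsReflexive X)
    (X : ModuleCat.{u} Λ) : AddSyzygy Λ 2 X ↔ IsFG X ∧ IsReflexive X := by
  have := isNoetherianRing_of_finite_algebra R Λ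
  have := isNoetherian_op_of_finite_algebra R Λ
  exact ⟨fun h => ⟨h.isFG, href X h⟩, fun h => addSyzygy_of_isFreeKernel (h.2.isFreeKernel h.1)⟩

theorem reflexiveFinite_iff (R : Type u) [CommRing R] [IsArtinianRing R]
    {Λ : Type u} [Ring Λ] [Algebra R Λ] [Module.Finite R Λ]
    (href : ∀ X : ModuleCat.{u} Λ, AddSyzygy Λ 2 X → IsReflexive X) :
    ReflexiveFinite Λ ↔ (ind (AddSyzygy Λ 2)).Finite := by
  unfold ReflexiveFinite
  rw [show (fun X : ModuleCat.{u} Λ => IsFG X ∧ IsReflexive X) = AddSyzygy Λ 2 from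
    funext fun X => propext (addSyzygy_iff R href X).symm]

theorem ExtendsUpToMul.isReflexive_of_addSyzygy {Λ : Type u} [Ring Λ] (H : ExtendsUpToMul Λ)
    (X : ModuleCat.{u} Λ) (hX : AddSyzygy Λ 2 X) : IsReflexive X := by
  obtain ⟨n, Y, hY, h⟩ := hX.exists_isRetract
  exact (isReflexive_pi Y fun i => (hY i).isReflexive H).of_isRetract
    (X := X) (Y := ModuleCat.of Λ (∀ i, Y i)) h

end ArtinAlgebras

/-! ### Transport along Morita equivalences -/

section Equivalences

variable {A B : Type u} [Ring A] [Ring B] (G : ModuleCat.{u} A ⥤ ModuleCat.{u} B)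

theorem indecomposable_of_isEquivalence [G.IsEquivalence] [G.Additive] {X : ModuleCat.{u} A}
    (hX : Indecomposable X) : Indecomposable (G.obj X) := by
  refine ⟨fun h => hX.1 ?_, fun Y Z i => ?_⟩
  · rw [Limits.IsZero.iff_id_eq_zero] at h ⊢
    exact G.map_injective (by rw [G.map_id, h, G.map_zero])
  · have := Limits.preservesBinaryBiproducts_of_preservesBiproducts G
    let e : X ≅ G.objPreimage Y ⊞ G.objPreimage Z := G.preimageIso
      (i ≪≫ Limits.biprod.mapIso (G.objObjPreimageIso Y).symm (G.objObjPreimageIso Z).symm ≪≫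
        (G.mapBiprod _ _).symm)
    exact (hX.2 _ _ e).imp (fun h => (G.map_isZero h).of_iso (G.objObjPreimageIso Y).symm)
      (fun h => (G.map_isZero h).of_iso (G.objObjPreimageIso Z).symm)

theorem finite_ind_of_isEquivalence [G.IsEquivalence] [G.Additive] {C : ModuleCat.{u} A → Prop}
    {D : ModuleCat.{u} B → Prop} (h : ∀ X, C X → Indecomposable X → D (G.obj X))
    (hD : (ind D).Finite) : (ind C).Finite := by
  let m : Quotient (isIsomorphicSetoid (ModuleCat.{u} A)) →
      Quotient (isIsomorphicSetoid (ModuleCat.{u} B)) :=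
    Quotient.map G.obj fun _ _ ⟨e⟩ => ⟨G.mapIso e⟩
  refine Set.Finite.of_injOn (f := m) (t := ind D) ?_ ?_ hD
  · rintro _ ⟨X, hX, hi, rfl⟩
    exact ⟨G.obj X, h X hX hi, indecomposable_of_isEquivalence G hi, rfl⟩
  · rintro _ ⟨X, -, -, rfl⟩ _ ⟨Y, -, -, rfl⟩ hXY
    obtain ⟨e⟩ := Quotient.exact hXY
    exact Quotient.sound ⟨G.preimageIso e⟩

/-- An equivalence of module categories maps the regular module to a finitely generated projective
module. -/
theorem isRetract_obj_self [G.IsEquivalence] [G.Additive] :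
    ∃ k : ℕ, IsRetract B (G.obj (ModuleCat.of A A)) (Fin k → B) := by
  classical
  let W := G.objPreimage (ModuleCat.of B B)
  let i : G.obj W ≅ ModuleCat.of B B := G.objObjPreimageIso (ModuleCat.of B B)
  let t : G.obj (ModuleCat.of A A) → (ModuleCat.of B B ⟶ G.obj (ModuleCat.of A A)) :=
    fun y => ModuleCat.ofHom (LinearMap.toSpanSingleton B _ y)
  let φ : G.obj (ModuleCat.of A A) → (W ⟶ ModuleCat.of A A) := fun y => G.preimage (i.hom ≫ t y)
  -- Trace argument: `W` corresponds to `B`, and `S` is the sum of the images of the maps `W → A`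
  -- coming from elements of `G A`. It is all of `A`, since the quotient map by `S` becomes zero
  -- under the faithful `G`.
  let S : Submodule A A := ⨆ y, LinearMap.range (φ y).hom
  have hS : S = ⊤ := by
    let q : ModuleCat.of A A ⟶ ModuleCat.of A (A ⧸ S) := ModuleCat.ofHom S.mkQ
    have h1 : ∀ y, φ y ≫ q = 0 := fun y => by
      ext w
      have : (φ y).hom w ∈ S := Submodule.mem_iSup_of_mem y ⟨w, rfl⟩
      exact (Submodule.Quotient.mk_eq_zero S).2 this
    have h2 : ∀ y, t y ≫ G.map q = 0 := fun y => by
      have := congrArg G.map (h1 y)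
      rw [G.map_comp, G.map_preimage, G.map_zero, Category.assoc] at this
      exact (cancel_epi i.hom).1 (by rw [this, Limits.comp_zero])
    have h3 : G.map q = 0 := by
      ext y
      have := congr($(h2 y).hom (1 : B))
      simpa [t] using this
    have h4 : q = 0 := G.map_injective (by rw [h3, G.map_zero])
    rw [← Submodule.ker_mkQ S, LinearMap.ker_eq_top]
    exact congr($(h4).hom)
  -- Writing `1` as a finite sum of values makes `A` a summand of a power of `W`, hence `G A` one of
  -- a power of `B`.
  have h1 : (1 : A) ∈ S := hS ▸ Submodule.mem_top
  obtain ⟨f, hf, hf1⟩ := (Submodule.mem_iSup_iff_exists_finsupp _ _).1 h1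
  choose w hw using hf
  let s := f.support
  let σ : G.obj (ModuleCat.of A A) → (ModuleCat.of A A ⟶ W) := fun y =>
    ModuleCat.ofHom (LinearMap.toSpanSingleton A _ (w y))
  have hσ : ∑ y ∈ s, σ y ≫ φ y = 𝟙 (ModuleCat.of A A) := by
    ext
    rw [ModuleCat.hom_sum, LinearMap.sum_apply]
    refine Eq.trans (Finset.sum_congr rfl fun y _ => ?_) hf1
    rw [← hw y]
    change (φ y).hom ((1 : A) • w y) = _
    rw [one_smul]
  have hG : ∑ y ∈ s, G.map (σ y) ≫ G.map (φ y) = 𝟙 (G.obj (ModuleCat.of A A)) := by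
    rw [← G.map_id, ← hσ, G.map_sum]
    simp only [G.map_comp]
  refine ⟨s.card, IsRetract.trans (Y := s → B) ⟨LinearMap.pi fun y => (G.map (σ y) ≫ i.hom).hom,
    ∑ y : s, (i.inv ≫ G.map (φ y)).hom ∘ₗ LinearMap.proj y, fun x => ?_⟩
    (.of_equiv (LinearEquiv.funCongrLeft B B s.equivFin.symm))⟩
  have h5 := congr($(hG).hom x)
  rw [ModuleCat.hom_sum, LinearMap.sum_apply, ← Finset.sum_coe_sort] at h5
  rw [LinearMap.sum_apply]
  refine Eq.trans (Finset.sum_congr rfl fun y _ => ?_) h5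
  simp

theorem isRetract_obj_pi [G.Additive] (n : ℕ) :
    IsRetract B (G.obj (ModuleCat.of A (Fin n → A))) (Fin n → G.obj (ModuleCat.of A A)) := by
  let p : ∀ _ : Fin n, ModuleCat.of A (Fin n → A) ⟶ ModuleCat.of A A := fun i =>
    ModuleCat.ofHom (LinearMap.proj i)
  let s : ∀ _ : Fin n, ModuleCat.of A A ⟶ ModuleCat.of A (Fin n → A) := fun i =>
    ModuleCat.ofHom (LinearMap.single A (fun _ => A) i)
  have h : ∑ i, p i ≫ s i = 𝟙 _ := by
    ext1
    rw [ModuleCat.hom_sum]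
    refine LinearMap.ext fun x => ?_
    rw [LinearMap.sum_apply]
    exact Finset.univ_sum_single (M := fun _ : Fin n => A) x
  have hG : ∑ i, G.map (p i) ≫ G.map (s i) = 𝟙 _ := by
    rw [← G.map_id, ← h, G.map_sum]
    simp only [G.map_comp]
  refine ⟨LinearMap.pi fun i => (G.map (p i)).hom, ∑ i, (G.map (s i)).hom ∘ₗ LinearMap.proj i,
    fun x => ?_⟩
  have h5 := congr($(hG).hom x)
  rw [ModuleCat.hom_sum, LinearMap.sum_apply] at h5
  rw [LinearMap.sum_apply]
  exact h5

/-- An equivalence is exact and sends `A` to a summand of a power of `B`. -/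
theorem isFreeKernel_obj [G.IsEquivalence] [G.Additive] {X : ModuleCat.{u} A}
    (hX : IsFreeKernel A A X) : IsFreeKernel B B (G.obj X) := by
  obtain ⟨k, hk⟩ := isRetract_obj_self G
  refine IsFreeKernel.of_isRetract hk ?_
  obtain ⟨n, m, f, ⟨e⟩⟩ := hX
  let ι : X ⟶ ModuleCat.of A (Fin n → A) := ModuleCat.ofHom (Submodule.subtype _ ∘ₗ e.toLinearMap)
  let g : ModuleCat.of A (Fin n → A) ⟶ ModuleCat.of A (Fin m → A) := ModuleCat.ofHom f
  have hιg : ι ≫ g = 0 := by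
    ext1
    exact LinearMap.ext fun x => (e x).2
  let S : ShortComplex (ModuleCat.{u} A) := ShortComplex.mk ι g hιg
  have hS : S.Exact := by
    rw [ShortComplex.moduleCat_exact_iff]
    intro x hx
    exact ⟨e.symm ⟨x, hx⟩, by simp [S, ι]⟩
  have hι : Function.Injective ι := by
    have : Function.Injective (Submodule.subtype (LinearMap.ker f) ∘ e) :=
      Subtype.val_injective.comp e.injective
    exact this
  have : Mono ι := (ModuleCat.mono_iff_injective ι).2 hι
  have hGι : Function.Injective (G.map ι).hom :=
    (ModuleCat.mono_iff_injective (G.map ι)).1 inferInstance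
  have hGS : (S.map G).Exact := hS.map G
  have hrange : LinearMap.range (G.map ι).hom = LinearMap.ker (G.map g).hom :=
    hGS.moduleCat_range_eq_ker
  exact (isFreeKernel_ker (isRetract_obj_pi G n) (isRetract_obj_pi G m) (G.map g).hom).of_equiv
    ((LinearEquiv.ofInjective _ hGι).trans (LinearEquiv.ofEq _ _ hrange))

end Equivalences

/-! ### Endomorphism rings of projective modules -/

section EndomorphismRings

variable {Γ : Type u} [Ring Γ] {P : Type u} [AddCommGroup P] [Module Γ P]

/-- If `Γ` has global dimension at most two, all kernels between free modules over the
endomorphism ring of a finitely generated projective `Γ`-module `P` are direct summands of powers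
of `Hom_Γ(P, Γ)`. -/
theorem IsFreeKernel.exists_isRetract_homMod [IsNoetherianRing Γ] [Module.Finite Γ P]
    [Module.Projective Γ P] (h : gldim Γ ≤ 2) {X : Type u} [AddCommGroup X]
    [Module (EndRing Γ P) X] (hX : IsFreeKernel (EndRing Γ P) (EndRing Γ P) X) :
    ∃ k : ℕ, IsRetract (EndRing Γ P) X (Fin k → HomMod Γ P Γ) := by
  obtain ⟨a, b, U, ⟨e⟩⟩ := hX
  have hproj : ∀ c : ℕ, Module.Projective Γ (Fin c → P) := fun c => by
    obtain ⟨n, hn⟩ := isRetract_of_finite_projective (Λ := Γ) (P := P)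
    exact (hn.pow c).projective
  have := hproj a
  have := hproj b
  -- Powers of `P` are projective, so the kernel of `matHom U` is too; `Hom_Γ(P, -)` carries it into
  -- `add Hom_Γ(P, Γ)`.
  have := projective_ker_of_gldim_le_two h (matHom U)
  obtain ⟨k, hk⟩ := isRetract_of_finite_projective (Λ := Γ) (P := LinearMap.ker (matHom U))
  exact ⟨k, (IsRetract.of_equiv e).trans (isRetract_ker_of_isRetract_ker_matHom U hk)⟩

variable {R : Type u} [CommRing R]

instance [Module R P] [SMulCommClass Γ R P] {N : Type*} [AddCommGroup N] [Module Γ N] [Module R N]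
    [SMulCommClass Γ R N] : Module R (HomMod Γ P N) :=
  inferInstanceAs (Module R (P →ₗ[Γ] N))

instance [Algebra R Γ] [Module R P] [IsScalarTower R Γ P] {N : Type*} [AddCommGroup N]
    [Module Γ N] [Module R N] [IsScalarTower R Γ N] :
    IsScalarTower R (EndRing Γ P) (HomMod Γ P N) :=
  ⟨fun r a f => HomMod.ext fun m => by
    have h : ∀ x : P, f (r • x) = r • f x := fun x => by
      rw [← algebraMap_smul Γ r x, map_smul, algebraMap_smul]
    exact h (a.unop m)⟩

/-- The Morita equivalence sends reflexive modules to kernels between free `End_Γ(P)`-modules, all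
of which lie in `add Hom_Γ(P, Γ)`; Krull–Schmidt bounds the indecomposables. -/
theorem reflexiveFinite_of_precedes [IsNoetherianRing R] (J : Ideal R) [IsAdicComplete J R]
    [IsArtinianRing (R ⧸ J)] {Λ : Type u} [Ring Λ] [Algebra R Λ] [Module.Finite R Λ]
    [Algebra R Γ] [Module.Finite R Γ] (h : gldim Γ ≤ 2) (hΓ : Precedes R Λ Γ) :
    ReflexiveFinite Λ := by
  obtain ⟨P, _, _, _, _, _, _, ⟨⟨e⟩⟩⟩ := hΓ
  have := isNoetherianRing_of_finite_algebra R Γ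
  have := isNoetherian_op_of_finite_algebra R Λ
  have : Module.Finite R P := Module.Finite.trans Γ P
  have hE : Module.Finite R (EndRing Γ P) := finite_endRing P
  have hEn := isNoetherianRing_of_finite_algebra R (EndRing Γ P)
  have : Module.Finite R (HomMod Γ P Γ) := finite_linearMap (R := R) (Λ := Γ) (X := P) (Y := Γ)
  have hW : IsNoetherian (EndRing Γ P) (HomMod Γ P Γ) :=
    isNoetherian_of_tower R (inferInstance : IsNoetherian R (HomMod Γ P Γ))
  let G := e.symm.eqv.functor
  refine finite_ind_of_isEquivalence G (fun X hX hi => ?_)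
    (finite_indecomposable_retracts (ModuleCat.of (EndRing Γ P) (HomMod Γ P Γ)))
  obtain ⟨k, hk⟩ := IsFreeKernel.exists_isRetract_homMod h
    (isFreeKernel_obj G (hX.2.isFreeKernel hX.1))
  have : Module.Finite (EndRing Γ P) (G.obj X) := hk.finite
  have : IsLocalRing (Module.End (EndRing Γ P) (G.obj X)) :=
    isLocalRing_end_of_finite J (indecomposable_of_isEquivalence G hi)
  exact ⟨this, hk.exists_of_pi.choose_spec⟩

end EndomorphismRings

/-! ### Orders and the expanded dimension -/

section Orders

/-- If `Λ` is a direct summand of `M`, then `Λ` is the endomorphism ring of the module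
`Hom_Λ(M, Λ)` over the endomorphism ring of `M`. -/
theorem exists_algEquiv_endRing_homMod {R : Type u} [CommRing R] {Λ : Type u} [Ring Λ]
    [Algebra R Λ] {M : Type u} [AddCommGroup M] [Module Λ M] [Module R M] [IsScalarTower R Λ M]
    (hM : IsRetract Λ Λ M) :
    Nonempty (Λ ≃ₐ[R] EndRing (EndRing Λ M) (HomMod Λ M Λ)) := by
  obtain ⟨ι, π, hιπ⟩ := hM
  let ρ : Λ → Module.End (EndRing Λ M) (HomMod Λ M Λ) := fun a =>
    HomMod.map (LinearMap.toSpanSingleton Λ Λ a)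
  have hρ : ∀ a f m, ρ a f m = f m * a := fun _ _ _ => rfl
  let Φ : Λ →ₐ[R] EndRing (EndRing Λ M) (HomMod Λ M Λ) :=
    AlgHom.ofLinearMap
      { toFun := fun a => MulOpposite.op (ρ a)
        map_add' := fun a b => MulOpposite.unop_injective (LinearMap.ext fun f =>
          HomMod.ext fun m => mul_add _ _ _)
        map_smul' := fun r a => MulOpposite.unop_injective (LinearMap.ext fun f =>
          HomMod.ext fun m => mul_smul_comm _ _ _) }
      (MulOpposite.unop_injective (LinearMap.ext fun f => HomMod.ext fun m => mul_one _))
      (fun a b => MulOpposite.unop_injective (LinearMap.ext fun f =>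
          HomMod.ext fun m => (mul_assoc _ _ _).symm))
  let π' : HomMod Λ M Λ := π
  refine ⟨AlgEquiv.ofBijective Φ ⟨fun a b hab => ?_, fun s => ?_⟩⟩
  · have h1 : ρ a π' (ι 1) = ρ b π' (ι 1) := by
      have : ρ a = ρ b := MulOpposite.op_injective hab
      rw [this]
    have h2 : ∀ c, ρ c π' (ι 1) = c := fun c => by
      rw [hρ]
      exact (congrArg (· * c) (hιπ 1)).trans (one_mul c)
    rw [← h2 a, ← h2 b, h1]
  · refine ⟨s.unop π' (ι 1), MulOpposite.unop_injective (LinearMap.ext fun f =>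
      HomMod.ext fun m => ?_)⟩
    -- `π` generates `Hom_Λ(M, Λ)` over `End_Λ(M)`, so `s` is determined by its value on `π`.
    have h1 : f = (MulOpposite.op (ι ∘ₗ (f : M →ₗ[Λ] Λ)) : EndRing Λ M) • π' :=
      HomMod.ext fun m => (hιπ (f m)).symm
    have h2 : s.unop f m = s.unop π' (ι (f m)) := by
      conv_lhs => rw [h1, map_smul]
      rfl
    rw [h2]
    change f m * s.unop π' (ι 1) = _
    rw [← smul_eq_mul, ← map_smul, ← map_smul, smul_eq_mul, mul_one]

/-- Over a principal ideal domain, finitely generated torsion-free modules are free, and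
torsion-freeness is inherited from `M`. -/
theorem isOrder_endRing {R : Type u} [CommRing R] [IsDomain R] [IsPrincipalIdealRing R]
    {Λ : Type u} [Ring Λ] [Algebra R Λ] {M : Type u} [AddCommGroup M] [Module Λ M] [Module R M]
    [IsScalarTower R Λ M] [Module.Finite R M] [Module.IsTorsionFree R M] :
    IsOrder R (EndRing Λ M) := by
  have h1 : Module.Finite R (EndRing Λ M) := finite_endRing M
  have h2 : Module.IsTorsionFree R (EndRing Λ M) := by
    let f : EndRing Λ M →ₗ[R] (M → M) :=
      { toFun := fun a => a.unop
        map_add' := fun _ _ => rfl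
        map_smul' := fun _ _ => rfl }
    have hf : Function.Injective f := fun a b h =>
      MulOpposite.unop_injective (LinearMap.ext fun m => congrFun h m)
    exact hf.moduleIsTorsionFree f (fun r a => map_smul f r a)
  have : Module.Free R (EndRing Λ M) := Module.free_of_finite_type_torsion_free'
  exact ⟨h1, inferInstance⟩

/-- The projective module is `Hom_Λ(M, Λ)`, a summand of `Hom_Λ(M, M)`. -/
theorem precedes_endRing {R : Type u} [CommRing R] {Λ : Type u} [Ring Λ]
    [Algebra R Λ] {M : Type u} [AddCommGroup M] [Module Λ M] [Module R M] [IsScalarTower R Λ M]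
    (hM : IsRetract Λ Λ M) : Precedes R Λ (EndRing Λ M) := by
  obtain ⟨e⟩ := exists_algEquiv_endRing_homMod (R := R) hM
  have hP : IsRetract (EndRing Λ M) (HomMod Λ M Λ) (EndRing Λ M) :=
    (HomMod.isRetract_map hM).trans (.of_equiv (HomMod.selfEquiv Λ M))
  exact ⟨HomMod Λ M Λ, inferInstance, inferInstance, inferInstance, inferInstance,
    hP.finite, hP.projective, IsMoritaEquivalent.of_algEquiv R e.symm⟩

theorem expDim_le_two_of_rFun_le_two {R : Type u} [CommRing R] [IsDomain R]
    [IsPrincipalIdealRing R] {Λ : Type u} [Ring Λ] [Algebra R Λ] (hΛ : IsOrder R Λ)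
    (h : rFun (IsLattice R) (ModuleCat.of Λ Λ) ≤ 2) : expDim R Λ ≤ 2 := by
  obtain ⟨N, hN, h⟩ := exists_of_rFun_le_two h
  obtain ⟨_, _⟩ := hΛ
  let : Module R N := moduleOfAlgebra R Λ N
  have := isScalarTower_moduleOfAlgebra R Λ N
  have h1 : Module.Finite R N := hN.1
  have h2 : Module.Projective R N := hN.2
  have : Module.Projective R (Λ × N) := inferInstance
  have : Module.IsTorsionFree R (Λ × N) := inferInstance
  refine le_trans (sInf_le ?_) h
  exact ⟨EndRing Λ (Λ × N), inferInstance, inferInstance, isOrder_endRing,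
    precedes_endRing (isRetract_fst N), rfl⟩

theorem isLattice_of_isFreeKernel {R : Type u} [CommRing R] [IsDomain R]
    [IsPrincipalIdealRing R] {Λ : Type u} [Ring Λ] [Algebra R Λ] (hΛ : IsOrder R Λ)
    {X : ModuleCat.{u} Λ} (hX : IsFreeKernel Λ Λ X) : IsLattice R X := by
  obtain ⟨_, _⟩ := hΛ
  obtain ⟨n, m, f, ⟨e⟩⟩ := hX
  let : Module R X := moduleOfAlgebra R Λ X
  have := isScalarTower_moduleOfAlgebra R Λ X
  let j : X →ₗ[R] (Fin n → Λ) := (Submodule.subtype _ ∘ₗ e.toLinearMap).restrictScalars R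
  have hj : Function.Injective j := Subtype.val_injective.comp e.injective
  have h1 : Module.Finite R X := Module.Finite.of_injective j hj
  have h2 : Module.IsTorsionFree R X := hj.moduleIsTorsionFree j fun r a => map_smul j r a
  have : Module.Free R X := Module.free_of_finite_type_torsion_free'
  exact ⟨h1, (inferInstance : Module.Projective R X)⟩

theorem rFun_isLattice_le_two_of_reflexiveFinite {R K Λ : Type u} [CommRing R] [IsDomain R]
    [IsPrincipalIdealRing R] [Field K] [Algebra R K] [IsFractionRing R K] [Ring Λ] [Algebra R Λ]
    (hΛ : IsOrder R Λ) [IsSemisimpleRing (K ⊗[R] Λ)] (h : ReflexiveFinite Λ) :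
    rFun (IsLattice R) (ModuleCat.of Λ Λ) ≤ 2 := by
  have hΛ' := hΛ
  obtain ⟨_, _⟩ := hΛ'
  have H : ExtendsUpToMul Λ := extendsUpToMul_of_isSemisimpleRing (R := R) (K := K)
  have := isNoetherianRing_of_finite_algebra R Λ
  have := isNoetherian_op_of_finite_algebra R Λ
  obtain ⟨N, hN, hN', h⟩ := exists_gldim_endRing_le_two (fun M hM => by
    have : Module.Finite Λ M := hM
    exact isNoetherianRing_endRing R (Λ := Λ) M) (fun X hX => hX.isReflexive H) h
  -- `N` is a lattice because, being reflexive, it embeds in some `Λ^n`.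
  exact rFun_le_two (isLattice_of_isFreeKernel hΛ (hN'.isFreeKernel hN)) h

theorem reflexiveFinite_of_expDim_le_two {R : Type u} [CommRing R] [IsDomain R]
    [IsDiscreteValuationRing R] [IsAdicComplete (IsLocalRing.maximalIdeal R) R] {Λ : Type u}
    [Ring Λ] [Algebra R Λ] (hΛ : IsOrder R Λ) (h : expDim R Λ ≤ 2) : ReflexiveFinite Λ := by
  obtain ⟨_, ⟨Γ, _, _, ⟨_, _⟩, hΓ, rfl⟩, h⟩ := exists_le_two_of_sInf_le_two h
  have := hΛ.1
  have : IsArtinianRing (R ⧸ IsLocalRing.maximalIdeal R) :=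
    inferInstanceAs (IsArtinianRing (IsLocalRing.ResidueField R))
  exact reflexiveFinite_of_precedes (IsLocalRing.maximalIdeal R) h hΓ

end Orders

end RepDim

theorem mainTheorem12 :
    -- artin algebras
    (∀ (R : Type u) [CommRing R] [IsArtinianRing R]
      (Λ : Type u) [Ring Λ] [Algebra R Λ] [Module.Finite R Λ],
      (RepDim.rFun RepDim.IsFG (ModuleCat.of Λ Λ) ≤ 2 →
        (RepDim.ind (RepDim.AddSyzygy Λ 2)).Finite) ∧
      ((∀ X : ModuleCat.{u} Λ, RepDim.AddSyzygy Λ 2 X → RepDim.IsReflexive X) →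
        (RepDim.ind (RepDim.AddSyzygy Λ 2)).Finite →
        RepDim.rFun RepDim.IsFG (ModuleCat.of Λ Λ) ≤ 2) ∧
      (RepDim.IsOneGorenstein Λ →
        (RepDim.rFun RepDim.IsFG (ModuleCat.of Λ Λ) ≤ 2 ↔ RepDim.ReflexiveFinite Λ))) ∧
    -- orders in semisimple algebras
    (∀ (R : Type u) [CommRing R] [IsDomain R] [IsDiscreteValuationRing R]
      [IsAdicComplete (IsLocalRing.maximalIdeal R) R]
      (K : Type u) [Field K] [Algebra R K] [IsFractionRing R K]
      (Λ : Type u) [Ring Λ] [Algebra R Λ],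
      RepDim.IsOrder R Λ → IsSemisimpleRing (K ⊗[R] Λ) →
      (RepDim.rFun (RepDim.IsLattice R) (ModuleCat.of Λ Λ) ≤ 2 ↔ RepDim.expDim R Λ ≤ 2) ∧
      (RepDim.expDim R Λ ≤ 2 ↔ RepDim.ReflexiveFinite Λ)) := by
  refine ⟨?_, ?_⟩
  · intro R _ _ Λ _ _ _
    refine ⟨RepDim.finite_ind_addSyzygy_of_rFun_le_two R, fun href hfin => ?_, fun hG => ?_⟩
    · exact RepDim.rFun_le_two_of_reflexiveFinite R href
        ((RepDim.reflexiveFinite_iff R href).2 hfin)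
    · have href := hG.extendsUpToMul.isReflexive_of_addSyzygy
      exact ⟨fun h => (RepDim.reflexiveFinite_iff R href).2
        (RepDim.finite_ind_addSyzygy_of_rFun_le_two R h),
        RepDim.rFun_le_two_of_reflexiveFinite R href⟩
  · intro R _ _ _ _ K _ _ _ Λ _ _ hΛ _
    have h1 := RepDim.expDim_le_two_of_rFun_le_two hΛ
    have h2 := RepDim.reflexiveFinite_of_expDim_le_two hΛ
    have h3 := RepDim.rFun_isLattice_le_two_of_reflexiveFinite (R := R) (K := K) hΛ
    exact ⟨⟨h1, fun h => h3 (h2 h)⟩, ⟨h2, fun h => h1 (h3 h)⟩⟩
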